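/- **Proposition 7.3.** Let $K$ be a field, let $h\ge 2$, and let $$A_h=\langle a_1,a_2,a_3,a_4\rangle=\langle h(h+1),\ h(h+1)+1,\ (h+1)^2,\ (h+1)^2+1\rangle\subset\mathbb N$$ be the Arslan semigroup. Let $K[A_h]\subset K[t]$ be the $K$-subalgebra generated by the monomials $t^s$ with $s\in A_h$, let $\mathfrak m=(t^s: s\in A_h\setminus\{0\})\subset K[A_h]$, and let $\operatorname{gr}_{\mathfrak m}K[A_h]=\bigoplus_{i\ge 0}\mathfrak m^i/\mathfrak m^{i+1}$ be the tangent cone. Regard both rings as modules over $S=K[x_1,x_2,x_3,x_4]$, where $x_i$ acts as multiplication by $t^{a_i}$ on $K[A_h]$, and by the class of $t^{a_i}$ in $\mathfrak m/\mathfrak m^2$ on $\operatorname{gr}_{\mathfrak m}K[A_h]$. For an $S$-module $M$ let $\beta_i(M)=\dim_K\operatorname{Tor}_i^S(M,K)$, where $K=S/(x_1,x_2,x_3,x_4)$ (this is the rank of the $i$-th free module in a minimal free $S$-resolution of $M$ when $M$ is one of these two modules). Then $K[A_h]$ and $\operatorname{gr}_{\mathfrak m}K[A_h]$ have the same Betti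 sequence $$(\beta_0,\beta_1,\beta_2,\beta_3)=(1,\ 2h+2,\ 4h,\ 2h-1),$$ and $\beta_i=0$ for all $i\ge 4$. -/

import Mathlib

noncomputable section

open CategoryTheory
open scoped DirectSum

/-! ### The associated graded ring `gr_I R = ⨁ i, I ^ i / I ^ (i + 1)` -/

namespace AssocGraded

variable {R : Type*} [CommRing R] (I : Ideal R)

/-- The graded piece `I ^ i / I ^ (i + 1)`. -/
def Piece (i : ℕ) : Type _ :=
  ↥(I ^ i) ⧸ (I ^ (i + 1)).submoduleOf (I ^ i)

instance (i : ℕ) : AddCommGroup (Piece I i) :=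
  inferInstanceAs (AddCommGroup (↥(I ^ i) ⧸ (I ^ (i + 1)).submoduleOf (I ^ i)))

instance (i : ℕ) : Module R (Piece I i) :=
  inferInstanceAs (Module R (↥(I ^ i) ⧸ (I ^ (i + 1)).submoduleOf (I ^ i)))

variable {I}

/-- The class of `r ∈ I ^ i` in `I ^ i / I ^ (i + 1)`. -/
def cls (i : ℕ) (r : R) (hr : r ∈ I ^ i) : Piece I i :=
  Submodule.Quotient.mk ⟨r, hr⟩

theorem cls_eq_iff {i : ℕ} {r s : R} (hr : r ∈ I ^ i) (hs : s ∈ I ^ i) :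
    cls i r hr = cls i s hs ↔ r - s ∈ I ^ (i + 1) :=
  Submodule.Quotient.eq ((I ^ (i + 1)).submoduleOf (I ^ i))

theorem exists_cls {i : ℕ} (a : Piece I i) : ∃ r, ∃ hr : r ∈ I ^ i, cls i r hr = a := by
  obtain ⟨⟨r, hr⟩, rfl⟩ := Submodule.Quotient.mk_surjective _ a
  exact ⟨r, hr, rfl⟩

theorem mul_mem_pow {i j : ℕ} {r s : R} (hr : r ∈ I ^ i) (hs : s ∈ I ^ j) :
    r * s ∈ I ^ (i + j) := by
  rw [pow_add]
  exact Ideal.mul_mem_mul hr hs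

variable (I) in
/-- The product `I ^ i × I ^ j → I ^ (i + j)`, read modulo `I ^ (i + j + 1)`. -/
def preMul (i j : ℕ) : ↥(I ^ i) →ₗ[R] ↥(I ^ j) →ₗ[R] Piece I (i + j) :=
  LinearMap.mk₂ R (fun a b => cls (i + j) (a.1 * b.1) (mul_mem_pow a.2 b.2))
    (fun a a' b => congrArg Submodule.Quotient.mk (Subtype.ext (add_mul a.1 a'.1 b.1)))
    (fun c a b => congrArg Submodule.Quotient.mk (Subtype.ext (mul_assoc c a.1 b.1)))
    (fun a b b' => congrArg Submodule.Quotient.mk (Subtype.ext (mul_add a.1 b.1 b'.1)))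
    (fun c a b => congrArg Submodule.Quotient.mk (Subtype.ext (mul_left_comm a.1 c b.1)))

variable (I) in
/-- The product `I ^ i / I ^ (i + 1) × I ^ j / I ^ (j + 1) → I ^ (i + j) / I ^ (i + j + 1)`. -/
def mulHom (i j : ℕ) : Piece I i →ₗ[R] Piece I j →ₗ[R] Piece I (i + j) :=
  Submodule.liftQ _
    (LinearMap.flip (Submodule.liftQ _ (LinearMap.flip (preMul I i j)) (by
      intro b hb
      rw [LinearMap.mem_ker]
      ext a
      change cls (i + j) (a.1 * b.1) _ = 0
      refine (Submodule.Quotient.mk_eq_zero _).2 ?_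
      exact (mul_mem_pow a.2 (show b.1 ∈ I ^ (j + 1) from hb) : a.1 * b.1 ∈ I ^ (i + (j + 1))))))
    (by
      intro a ha
      rw [LinearMap.mem_ker]
      refine LinearMap.ext fun b => ?_
      obtain ⟨s, hs, rfl⟩ := exists_cls b
      change cls (i + j) (a.1 * s) _ = 0
      refine (Submodule.Quotient.mk_eq_zero _).2 ?_
      have := mul_mem_pow (show a.1 ∈ I ^ (i + 1) from ha) hs
      rwa [add_right_comm] at this)

theorem mulHom_cls {i j : ℕ} {r s : R} (hr : r ∈ I ^ i) (hs : s ∈ I ^ j) :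
    mulHom I i j (cls i r hr) (cls j s hs) = cls (i + j) (r * s) (mul_mem_pow hr hs) := rfl

theorem sigma_ext {i j : ℕ} {r s : R} (hij : i = j) (hr : r ∈ I ^ i) (hs : s ∈ I ^ j)
    (h : r = s) :
    (GradedMonoid.mk i (cls i r hr) : GradedMonoid (Piece I)) = GradedMonoid.mk j (cls j s hs) := by
  subst hij h
  rfl

theorem one_mem_pow_zero : (1 : R) ∈ I ^ 0 := by simp

theorem mem_pow_zero (r : R) : r ∈ I ^ 0 := by simp

instance : GradedMonoid.GMul (Piece I) where
  mul {i j} a b := mulHom I i j a b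

instance : GradedMonoid.GOne (Piece I) where
  one := cls 0 1 one_mem_pow_zero

theorem gmul_cls {i j : ℕ} {r s : R} (hr : r ∈ I ^ i) (hs : s ∈ I ^ j) :
    GradedMonoid.mk i (cls i r hr) * GradedMonoid.mk j (cls j s hs) =
      (GradedMonoid.mk (i + j) (cls (i + j) (r * s) (mul_mem_pow hr hs)) :
        GradedMonoid (Piece I)) := rfl

theorem gone_cls :
    (1 : GradedMonoid (Piece I)) = GradedMonoid.mk 0 (cls 0 1 one_mem_pow_zero) := rfl

instance : DirectSum.GCommRing (Piece I) where
  mul_zero a := map_zero _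
  zero_mul b := by
    change mulHom I _ _ 0 b = 0
    rw [map_zero, LinearMap.zero_apply]
  mul_add a b c := map_add _ _ _
  add_mul a b c := by
    change mulHom I _ _ (a + b) c = mulHom I _ _ a c + mulHom I _ _ b c
    rw [map_add, LinearMap.add_apply]
  one_mul := by
    rintro ⟨i, a⟩
    obtain ⟨r, hr, rfl⟩ := exists_cls a
    exact sigma_ext (zero_add i) _ _ (one_mul r)
  mul_one := by
    rintro ⟨i, a⟩
    obtain ⟨r, hr, rfl⟩ := exists_cls a
    exact sigma_ext (add_zero i) _ _ (mul_one r)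
  mul_assoc := by
    rintro ⟨i, a⟩ ⟨j, b⟩ ⟨k, c⟩
    obtain ⟨r, hr, rfl⟩ := exists_cls a
    obtain ⟨s, hs, rfl⟩ := exists_cls b
    obtain ⟨t, ht, rfl⟩ := exists_cls c
    exact sigma_ext (add_assoc i j k) _ _ (mul_assoc r s t)
  mul_comm := by
    rintro ⟨i, a⟩ ⟨j, b⟩
    obtain ⟨r, hr, rfl⟩ := exists_cls a
    obtain ⟨s, hs, rfl⟩ := exists_cls b
    exact sigma_ext (add_comm i j) _ _ (mul_comm r s)
  natCast n := cls 0 (n : R) (mem_pow_zero _)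
  natCast_zero := by
    refine (Submodule.Quotient.mk_eq_zero _).2 ?_
    change ((0 : ℕ) : R) ∈ I ^ (0 + 1)
    simp
  natCast_succ n := by
    change cls 0 ((n + 1 : ℕ) : R) (mem_pow_zero _) =
      cls 0 ((n : R) + 1) (mem_pow_zero _)
    congr 1
    push_cast
    rfl
  intCast n := cls 0 (n : R) (mem_pow_zero _)
  intCast_ofNat n := by
    congr 1
    push_cast
    rfl
  intCast_negSucc_ofNat n := by
    change cls 0 ((Int.negSucc n : ℤ) : R) (mem_pow_zero _) =
      cls 0 (-((n + 1 : ℕ) : R)) (mem_pow_zero _)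
    congr 1
    push_cast
    ring

end AssocGraded

/-- The associated graded ring `gr_I R = ⨁ i, I ^ i / I ^ (i + 1)`, with the product induced by
the one of `R`. -/
abbrev AssocGradedRing {R : Type*} [CommRing R] (I : Ideal R) : Type _ :=
  ⨁ i : ℕ, AssocGraded.Piece I i

/-- The canonical map `R → R / I = I ^ 0 / I ^ 1 ⊆ gr_I R` onto the degree zero part. -/
def AssocGradedRing.degZero {R : Type*} [CommRing R] (I : Ideal R) : R →+* AssocGradedRing I where
  toFun r := DirectSum.of (AssocGraded.Piece I) 0 (AssocGraded.cls 0 r (AssocGraded.mem_pow_zero r))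
  map_zero' := by
    rw [← map_zero (DirectSum.of (AssocGraded.Piece I) 0)]
    rfl
  map_one' := rfl
  map_add' r s := by
    rw [← map_add]
    rfl
  map_mul' r s := by
    rw [DirectSum.of_mul_of]
    rfl

/-! ### Betti numbers over a polynomial ring -/

universe u

section Betti

variable {K : Type u} [Field K] {n : ℕ}

/-- The `S`-module underlying a ring `R` over `S = K[x₁, …, xₙ]` with structure map `φ`. -/
def moduleOfRingHom {R : Type u} [CommRing R] (φ : MvPolynomial (Fin n) K →+* R) :
    ModuleCat.{u} (MvPolynomial (Fin n) K) :=
  (ModuleCat.restrictScalars φ).obj (ModuleCat.of R R)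

variable (K n) in
/-- The residue field `K = S / (x₁, …, xₙ)` as a module over `S = K[x₁, …, xₙ]`. -/
def residueModule : ModuleCat.{u} (MvPolynomial (Fin n) K) :=
  moduleOfRingHom (MvPolynomial.constantCoeff : MvPolynomial (Fin n) K →+* K)

/-- The Betti number `β_i(M) = dim_K Tor_i^S(M, K)` of a module `M` over `S = K[x₁, …, xₙ]`,
as a cardinal. -/
def bettiNumber (M : ModuleCat.{u} (MvPolynomial (Fin n) K)) (i : ℕ) : Cardinal.{u} :=
  Module.rank K ((ModuleCat.restrictScalars (algebraMap K (MvPolynomial (Fin n) K))).obj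
    (((Tor (ModuleCat.{u} (MvPolynomial (Fin n) K)) i).obj M).obj (residueModule K n)))

/-- `M` has Betti sequence `(b₀, …, bₗ)`: `β_i(M) = b_i` for `i ≤ l`, and `β_i(M) = 0` for all
`i > l`. -/
def HasBettiSequence (M : ModuleCat.{u} (MvPolynomial (Fin n) K)) (b : List ℕ) : Prop :=
  ∀ i : ℕ, bettiNumber M i = ((b.getD i 0 : ℕ) : Cardinal.{u})

end Betti

/-! ### Semigroup rings of submonoids of `ℕ` and their tangent cones -/

section SemigroupRing

variable (K : Type u) [Field K]

/-- The semigroup ring `K[H]`: the subalgebra of `K[t]` generated by the `t ^ s` with `s ∈ H`. -/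
def semigroupRing (H : AddSubmonoid ℕ) : Subalgebra K (Polynomial K) :=
  Algebra.adjoin K {p | ∃ s ∈ H, p = (Polynomial.X : Polynomial K) ^ s}

variable {K} in
/-- The monomial `t ^ s` as an element of `K[H]`, for `s ∈ H`. -/
def semigroupRing.mono {H : AddSubmonoid ℕ} (s : ℕ) (hs : s ∈ H) : semigroupRing K H :=
  ⟨(Polynomial.X : Polynomial K) ^ s, Algebra.subset_adjoin ⟨s, hs, rfl⟩⟩

/-- The ideal `𝔪 = (t ^ s : s ∈ H, s ≠ 0)` of `K[H]`. -/
def semigroupRing.maxIdeal (H : AddSubmonoid ℕ) : Ideal (semigroupRing K H) :=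
  Ideal.span {f | ∃ (s : ℕ) (hs : s ∈ H), s ≠ 0 ∧ f = semigroupRing.mono s hs}

/-- The tangent cone `gr_𝔪 K[H]`. -/
abbrev tangentCone (H : AddSubmonoid ℕ) : Type u :=
  AssocGradedRing (semigroupRing.maxIdeal K H)

variable {n : ℕ} (a : Fin n → ℕ)

/-- The submonoid `⟨a₁, …, aₙ⟩` of `ℕ`. -/
def generatedSemigroup : AddSubmonoid ℕ := AddSubmonoid.closure (Set.range a)

theorem gen_mem_generatedSemigroup (i : Fin n) : a i ∈ generatedSemigroup a :=
  AddSubmonoid.subset_closure ⟨i, rfl⟩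

/-- The generator `t ^ (aᵢ)` of `K[⟨a₁, …, aₙ⟩]`. -/
def genMono (i : Fin n) : semigroupRing K (generatedSemigroup a) :=
  semigroupRing.mono (a i) (gen_mem_generatedSemigroup a i)

/-- The presentation `S = K[x₁, …, xₙ] → K[⟨a₁, …, aₙ⟩]`, `xᵢ ↦ t ^ (aᵢ)`. -/
def semigroupRingPresentation :
    MvPolynomial (Fin n) K →+* semigroupRing K (generatedSemigroup a) :=
  (MvPolynomial.aeval (genMono K a)).toRingHom

theorem genMono_mem {a : Fin n → ℕ} (ha : ∀ i, a i ≠ 0) (i : Fin n) :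
    genMono K a i ∈ semigroupRing.maxIdeal K (generatedSemigroup a) ^ 1 := by
  rw [pow_one]
  exact Ideal.subset_span ⟨a i, gen_mem_generatedSemigroup a i, ha i, rfl⟩

variable {a} in
/-- The presentation `S = K[x₁, …, xₙ] → gr_𝔪 K[⟨a₁, …, aₙ⟩]`, which sends `xᵢ` to the class of
`t ^ (aᵢ)` in `𝔪 / 𝔪 ^ 2`. -/
def tangentConePresentation (ha : ∀ i, a i ≠ 0) :
    MvPolynomial (Fin n) K →+* tangentCone K (generatedSemigroup a) :=
  MvPolynomial.eval₂Hom
    ((AssocGradedRing.degZero (semigroupRing.maxIdeal K (generatedSemigroup a))).comp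
      (algebraMap K (semigroupRing K (generatedSemigroup a))))
    (fun i => DirectSum.of
      (AssocGraded.Piece (semigroupRing.maxIdeal K (generatedSemigroup a))) 1
      (AssocGraded.cls 1 (genMono K a i) (genMono_mem K ha i)))

end SemigroupRing

/-! ### The Arslan semigroups -/

/-- The generators of the Arslan semigroup
`A_h = ⟨h(h+1), h(h+1)+1, (h+1)^2, (h+1)^2+1⟩`. -/
def arslanGen (h : ℕ) : Fin 4 → ℕ :=
  ![h * (h + 1), h * (h + 1) + 1, (h + 1) ^ 2, (h + 1) ^ 2 + 1]

theorem arslanGen_ne_zero {h : ℕ} (hh : 2 ≤ h) (i : Fin 4) : arslanGen h i ≠ 0 := by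
  have h0 : h ≠ 0 := by omega
  fin_cases i <;> simp [arslanGen, h0]

/-- For `h ≥ 2` the four generators form the minimal generating set of `A_h`: none of them lies in
the submonoid generated by the other three. So `K[x₁, x₂, x₃, x₄]` is the polynomial ring over
which the Betti numbers of `A_h` are to be taken. -/
theorem arslanGen_minimal {h : ℕ} (hh : 2 ≤ h) (i : Fin 4) :
    arslanGen h i ∉ AddSubmonoid.closure (arslanGen h '' {i}ᶜ) := by
  have h1 : ∀ j, h * (h + 1) ≤ arslanGen h j := by
    intro j
    fin_cases j <;> simp [arslanGen] <;> nlinarith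
  have h2 : ∀ j, arslanGen h j < 2 * (h * (h + 1)) := by
    intro j
    fin_cases j <;> simp [arslanGen] <;> nlinarith
  have h3 : Function.Injective (arslanGen h) := by
    intro j k hjk
    fin_cases j <;> fin_cases k <;> simp [arslanGen] at hjk ⊢ <;> nlinarith
  have key : ∀ x ∈ AddSubmonoid.closure (arslanGen h '' {i}ᶜ),
      x = 0 ∨ x ∈ arslanGen h '' {i}ᶜ ∨ 2 * (h * (h + 1)) ≤ x := by
    intro x hx
    have low : ∀ y, y ∈ arslanGen h '' {i}ᶜ → h * (h + 1) ≤ y := by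
      rintro _ ⟨j, -, rfl⟩
      exact h1 j
    induction hx using AddSubmonoid.closure_induction with
    | mem x hx => exact Or.inr (Or.inl hx)
    | zero => exact Or.inl rfl
    | add x y _ _ ihx ihy =>
      rcases ihx with rfl | hx | hx
      · simpa using ihy
      · rcases ihy with rfl | hy | hy
        · exact Or.inr (Or.inl (by simpa using hx))
        · have := low x hx
          have := low y hy
          omega
        · omega
      · omega
  intro hmem
  rcases key _ hmem with h0 | ⟨j, hj, hji⟩ | hge
  · exact arslanGen_ne_zero hh i h0
  · exact hj (h3 hji)
  · exact absurd (h2 i) (by omega)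

end

noncomputable section

open CategoryTheory
open scoped DirectSum

universe u v

/-! Number the variables x₀, …, x₃. Multiplication by x₀ is injective on `K[A_h]` and on its tangent
cone, and modulo x₀ both become the same module over `K[x₁, x₂, x₃]`: the quotient by the monomial
ideal J generated by x₁x₂, the monomials of degree h in x₂, x₃, and x₁² times those of degree h - 1
in x₁, x₃. The monomials outside J form a finite staircase B. Betti numbers are unchanged on passing
to this quotient, and for an Artinian monomial quotient in three variables they can be counted: β₀ =
1, β₁ is the number of minimal generators of J (2h + 2), β₃ is the number of maximal elements of B
(2h - 1), and the vanishing Euler characteristic gives β₂ = 4h.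

The arithmetic rests on two facts about factorizations. By `eq_of_mem_arslanStaircase` the value of
a point of B has no other factorization in the semigroup: reduce modulo h + 1, then modulo h. By
`exists_factorization_of_notMem` any monomial in x₁, x₂, x₃ outside B can be rewritten with a factor
x₀, through x₁x₂ → x₀x₃, x₂ᵏx₃ⁱ → x₀ᵏ⁺¹x₁ⁱ for i + k = h, and x₁ʰ⁻ʳ⁺¹x₃ʳ → x₀ʰ⁻ʳx₂ʳ⁺¹ for r < h.
Hence the values of B are the Apéry set of the first generator, which settles the semigroup ring. No
rewriting shortens a factorization; since `maxIdeal_pow_eq` describes the powers of 𝔪 by lengths of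
factorizations, adding the first generator raises the 𝔪-adic order by exactly one
(`mem_arslanLevel_of_add`), and the same argument works for the tangent cone.

On the homological side, `nonempty_tor_equiv_koszulH` turns Tor against the residue field into
Koszul homology, `nonempty_koszulH_equiv` removes x₀, and `rank_koszulH_staircase_zero`,
`rank_koszulH_staircase_one`, `rank_koszulH_staircase_three` and `koszulH_euler_three` do the count.
-/

/-! ### The Koszul complex of a sequence of commuting operators -/

/-- An index set for a basis of the `i`-th exterior power of a free module of rank `n`: the subsets
of `{0, …, n - 1}` with `i` elements, where `inr` adds the largest element. -/
inductive KoszulIndex : ℕ → ℕ → Type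
  | nil : KoszulIndex 0 0
  | inl {n i : ℕ} : KoszulIndex n i → KoszulIndex (n + 1) i
  | inr {n i : ℕ} : KoszulIndex n i → KoszulIndex (n + 1) (i + 1)

namespace KoszulIndex

instance finite : (n i : ℕ) → Finite (KoszulIndex n i)
  | 0, 0 => Finite.of_injective (fun _ => ()) (by rintro ⟨⟩ ⟨⟩ _; rfl)
  | 0, _ + 1 => Finite.of_injective (β := Empty) (fun j => nomatch j) (fun j => nomatch j)
  | n + 1, 0 =>
    have := finite n 0
    Finite.of_surjective (inl : KoszulIndex n 0 → _) (by rintro (_ | j | _); exact ⟨j, rfl⟩)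
  | n + 1, i + 1 =>
    have := finite n (i + 1)
    have := finite n i
    Finite.of_surjective
      (Sum.elim inl inr : KoszulIndex n (i + 1) ⊕ KoszulIndex n i → KoszulIndex (n + 1) (i + 1))
      (by rintro (_ | j | j); exacts [⟨Sum.inl j, rfl⟩, ⟨Sum.inr j, rfl⟩])

theorem le {n i : ℕ} (j : KoszulIndex n i) : i ≤ n := by
  induction j with
  | nil => exact le_rfl
  | inl j ih => omega
  | inr j ih => omega

theorem isEmpty_of_lt {n i : ℕ} (h : n < i) : IsEmpty (KoszulIndex n i) :=
  ⟨fun j => absurd j.le (by omega)⟩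

/-- The index of the empty subset. -/
def base : (n : ℕ) → KoszulIndex n 0
  | 0 => nil
  | n + 1 => inl (base n)

theorem eq_base : ∀ {n : ℕ} (j : KoszulIndex n 0), j = base n
  | 0, nil => rfl
  | _ + 1, inl j => congrArg inl (eq_base j)

/-- The family with the given restrictions along `inl` and `inr`. -/
def glue {V : Type*} {n i : ℕ} (a : KoszulIndex n (i + 1) → V) (b : KoszulIndex n i → V) :
    KoszulIndex (n + 1) (i + 1) → V
  | inl j => a j
  | inr j => b j

end KoszulIndex

open KoszulIndex

section Koszul

variable {A V W : Type*} [CommRing A] [AddCommGroup V] [Module A V] [AddCommGroup W] [Module A W]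

/-- The differential of the Koszul complex, as a function. -/
def koszulFun (x : ℕ → Module.End A V) :
    {n i : ℕ} → (KoszulIndex n (i + 1) → V) → KoszulIndex n i → V
  | _, _, _, nil => 0
  | n + 1, _, v, inl j => koszulFun x (fun k => v (inl k)) j + x n (v (inr j))
  | _, _, v, inr j => - koszulFun x (fun k => v (inr k)) j

/-- The differential of the Koszul complex of `x 0, …, x (n - 1)`, as an iterated mapping cone. -/
def koszulD (x : ℕ → Module.End A V) (n i : ℕ) :
    (KoszulIndex n (i + 1) → V) →ₗ[A] (KoszulIndex n i → V) where
  toFun v j := koszulFun x v j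
  map_add' v w := by
    funext j
    induction j with
    | nil => exact (add_zero 0).symm
    | inl j ih =>
      have := ih (fun k => v (inl k)) (fun k => w (inl k))
      simp only [koszulFun, Pi.add_apply, map_add] at this ⊢
      rw [← add_add_add_comm, ← this]
      rfl
    | inr j ih =>
      have := ih (fun k => v (inr k)) (fun k => w (inr k))
      simp only [koszulFun, Pi.add_apply] at this ⊢
      rw [← neg_add, ← this]
      rfl
  map_smul' c v := by
    funext j
    induction j with
    | nil => exact (smul_zero c).symm
    | inl j ih =>
      have := ih (fun k => v (inl k))
      simp only [koszulFun, Pi.smul_apply, map_smul, RingHom.id_apply, smul_add] at this ⊢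
      rw [← this]
      rfl
    | inr j ih =>
      have := ih (fun k => v (inr k))
      simp only [koszulFun, Pi.smul_apply, RingHom.id_apply, smul_neg] at this ⊢
      rw [← this]
      rfl

variable (x : ℕ → Module.End A V) (y : ℕ → Module.End A W)

theorem koszulD_inl (n i : ℕ) (v : KoszulIndex (n + 1) (i + 1) → V) (j : KoszulIndex n i) :
    koszulD x (n + 1) i v (inl j) =
      koszulD x n i (fun k => v (inl k)) j + x n (v (inr j)) := rfl

theorem koszulD_inr (n i : ℕ) (v : KoszulIndex (n + 1) (i + 2) → V) (j : KoszulIndex n i) :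
    koszulD x (n + 1) (i + 1) v (inr j) = - koszulD x n i (fun k => v (inr k)) j := rfl

/-- An additive map that intertwines the operators commutes with the Koszul differentials. -/
theorem koszulD_naturality {B U : Type*} [CommRing B] [AddCommGroup U] [Module B U]
    (y : ℕ → Module.End B U)
    (f : V →+ U) (n : ℕ) (hf : ∀ k < n, ∀ v, f (x k v) = y k (f v)) (i : ℕ)
    (v : KoszulIndex n (i + 1) → V) (j : KoszulIndex n i) :
    koszulD y n i (fun k => f (v k)) j = f (koszulD x n i v j) := by
  induction j with
  | nil => exact (map_zero f).symm
  | inl j ih =>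
    rw [koszulD_inl, koszulD_inl, map_add, hf _ (by omega), ← ih fun k hk => hf k (by omega)]
  | inr j ih => rw [koszulD_inr, koszulD_inr, map_neg, ← ih fun k hk => hf k (by omega)]

variable {x}

theorem koszulD_operator (hx : ∀ k l v, x k (x l v) = x l (x k v)) (n i m : ℕ)
    (v : KoszulIndex n (i + 1) → V) (j : KoszulIndex n i) :
    koszulD x n i (fun k => x m (v k)) j = x m (koszulD x n i v j) :=
  koszulD_naturality x x (x m).toAddMonoidHom n (fun k _ v => hx m k v) i v j

/-- On the `inl` part the two mixed terms cancel: the sign in the `inr` component of the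
differential makes `x n` anticommute past the smaller differential. -/
theorem koszulD_comp (hx : ∀ k l v, x k (x l v) = x l (x k v)) (n i : ℕ)
    (v : KoszulIndex n (i + 2) → V) : koszulD x n i (koszulD x n (i + 1) v) = 0 := by
  funext j
  induction j with
  | nil => rfl
  | @inl n i j ih =>
    rw [koszulD_inl]
    have h1 : (fun k => koszulD x (n + 1) (i + 1) v (inl k)) =
        koszulD x n (i + 1) (fun k => v (inl k)) + fun k => x n (v (inr k)) := rfl
    rw [h1, map_add, Pi.add_apply, ih, koszulD_inr, map_neg, koszulD_operator hx]
    simp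
  | @inr n i j ih =>
    rw [koszulD_inr]
    have h1 : (fun k => koszulD x (n + 1) (i + 2) v (inr k)) =
        - koszulD x n (i + 1) (fun k => v (inr k)) := rfl
    rw [h1, map_neg, Pi.neg_apply, ih]
    simp

/-- If every `x m` is injective modulo the image of the previous operators, then the Koszul complex
is exact in positive degrees. -/
theorem koszulD_exact (hx : ∀ k l v, x k (x l v) = x l (x k v)) (n : ℕ)
    (hreg : ∀ m < n, ∀ w : KoszulIndex m 0 → V,
      (fun j => x m (w j)) ∈ LinearMap.range (koszulD x m 0) →
        w ∈ LinearMap.range (koszulD x m 0)) (i : ℕ)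
    (v : KoszulIndex n (i + 1) → V) (hv : koszulD x n i v = 0) :
    v ∈ LinearMap.range (koszulD x n (i + 1)) := by
  induction n generalizing i with
  | zero =>
    have := KoszulIndex.isEmpty_of_lt (show 0 < i + 1 by omega)
    exact ⟨0, Subsingleton.elim _ _⟩
  | succ n ih =>
    have ih := ih fun m hm => hreg m (by omega)
    have hinl : koszulD x n i (fun k => v (inl k)) = - fun j => x n (v (inr j)) := by
      funext j
      have := congrFun hv (inl j)
      rw [koszulD_inl] at this
      exact eq_neg_of_add_eq_zero_left this
    -- The `inr` part of a cycle is a cycle one degree lower. When that degree is zero the cycle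
    -- condition is void, and regularity of `x n` replaces it, since `hinl` makes `x n` times the
    -- `inr` part a boundary.
    obtain ⟨b, hb⟩ : ∃ b, koszulD x n i b = fun k => v (inr k) := by
      cases i with
      | zero =>
        refine hreg n (by omega) _ ⟨- fun k => v (inl k), ?_⟩
        rw [map_neg, hinl, neg_neg]
      | succ i =>
        refine ih i _ ?_
        funext j
        have := congrFun hv (inr j)
        rw [koszulD_inr] at this
        simpa using this
    -- Adding `x n b` turns the `inl` part into a cycle of the smaller complex; the sign of `b` in
    -- the preimage undoes this correction.
    obtain ⟨a, ha⟩ := ih i ((fun k => v (inl k)) + fun k => x n (b k)) (by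
      rw [map_add, hinl]
      funext j
      rw [Pi.add_apply, koszulD_operator hx, hb]
      simp)
    refine ⟨glue a (- b), ?_⟩
    funext j
    cases j with
    | inl j =>
      have := congrFun ha j
      simp only [Pi.add_apply] at this
      simp [koszulD_inl, glue, this]
    | inr j =>
      have := congrFun hb j
      have h1 : (fun k => (glue a (-b)) (inr k)) = - b := rfl
      rw [koszulD_inr, h1, map_neg, Pi.neg_apply, this, neg_neg]

theorem mem_range_koszulD_zero (w : KoszulIndex 0 0 → V) :
    w ∈ LinearMap.range (koszulD x 0 0) ↔ w (base 0) = 0 := by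
  constructor
  · rintro ⟨v, rfl⟩
    rfl
  · intro hw
    refine ⟨0, funext fun j => ?_⟩
    rw [eq_base j, hw, map_zero]
    rfl

theorem mem_range_koszulD_succ (n : ℕ) (w : KoszulIndex (n + 1) 0 → V) :
    w ∈ LinearMap.range (koszulD x (n + 1) 0) ↔
      ∃ b : V, (fun j => w (inl j) - x n b) ∈ LinearMap.range (koszulD x n 0) := by
  constructor
  · rintro ⟨v, rfl⟩
    refine ⟨v (inr (base n)), fun j => v (inl j), funext fun j => ?_⟩
    rw [koszulD_inl, eq_base j, add_sub_cancel_right]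
  · rintro ⟨b, a, ha⟩
    refine ⟨glue a fun _ => b, funext fun j => ?_⟩
    cases j with
    | inl j =>
      rw [koszulD_inl]
      change koszulD x n 0 a j + x n b = _
      rw [ha, sub_add_cancel]

variable (x)

/-- The cycles of the Koszul complex. -/
def koszulZ (n : ℕ) : (i : ℕ) → Submodule A (KoszulIndex n i → V)
  | 0 => ⊤
  | i + 1 => LinearMap.ker (koszulD x n i)

/-- The homology of the Koszul complex. -/
abbrev KoszulH (n i : ℕ) : Type _ :=
  koszulZ x n i ⧸ (LinearMap.range (koszulD x n i)).submoduleOf (koszulZ x n i)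

variable {x y}

theorem range_koszulD_le (hx : ∀ k l v, x k (x l v) = x l (x k v)) (n i : ℕ) :
    LinearMap.range (koszulD x n i) ≤ koszulZ x n i := by
  cases i with
  | zero => exact le_top
  | succ i =>
    rintro _ ⟨v, rfl⟩
    exact koszulD_comp hx n i v

/-- Composition with `f`, restricted to the part of the Koszul complex that does not involve the
last operator. -/
def koszulRestrict (f : V →ₗ[A] W) (n i : ℕ) :
    (KoszulIndex (n + 1) i → V) →ₗ[A] (KoszulIndex n i → W) :=
  f.compLeft _ ∘ₗ LinearMap.funLeft A V inl

theorem koszulRestrict_apply (f : V →ₗ[A] W) (n i : ℕ) (v : KoszulIndex (n + 1) i → V)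
    (j : KoszulIndex n i) : koszulRestrict f n i v j = f (v (inl j)) := rfl

theorem koszulD_koszulRestrict (f : V →ₗ[A] W) (n : ℕ) (hf : ∀ k < n, ∀ v, f (x k v) = y k (f v))
    (hn : ∀ v, f (x n v) = 0) (i : ℕ) (v : KoszulIndex (n + 1) (i + 1) → V) :
    koszulD y n i (koszulRestrict f n (i + 1) v) =
      koszulRestrict f n i (koszulD x (n + 1) i v) := by
  funext j
  rw [koszulRestrict_apply, koszulD_inl, map_add, hn, add_zero]
  exact koszulD_naturality x y f.toAddMonoidHom n hf i (fun k => v (inl k)) j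

theorem koszulRestrict_mem (f : V →ₗ[A] W) (n : ℕ) (hf : ∀ k < n, ∀ v, f (x k v) = y k (f v))
    (hn : ∀ v, f (x n v) = 0) (i : ℕ) (v : KoszulIndex (n + 1) i → V)
    (hv : v ∈ koszulZ x (n + 1) i) : koszulRestrict f n i v ∈ koszulZ y n i := by
  cases i with
  | zero => trivial
  | succ i =>
    change koszulD y n i _ = 0
    rw [koszulD_koszulRestrict f n hf hn, show koszulD x (n + 1) i v = 0 from hv, map_zero]

/-- Koszul homology does not change when one passes to the quotient by an injective operator. -/
theorem nonempty_koszulH_equiv (hx : ∀ k l v, x k (x l v) = x l (x k v))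
    (f : V →ₗ[A] W) (n : ℕ) (hf : ∀ k < n, ∀ v, f (x k v) = y k (f v))
    (hsurj : Function.Surjective f) (hinj : Function.Injective (x n))
    (hker : ∀ v, f v = 0 ↔ v ∈ LinearMap.range (x n)) (i : ℕ) :
    Nonempty (KoszulH x (n + 1) i ≃ₗ[A] KoszulH y n i) := by
  have hn : ∀ v, f (x n v) = 0 := fun v => (hker _).2 ⟨v, rfl⟩
  have lift : ∀ {ι : Type} (w : ι → W), ∃ v : ι → V, (fun j => f (v j)) = w := fun w =>
    ⟨fun j => (hsurj (w j)).choose, funext fun j => (hsurj (w j)).choose_spec⟩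
  have hlift : ∀ {ι : Type} (v : ι → V), (∀ j, f (v j) = 0) → ∃ b : ι → V,
      ∀ j, v j = x n (b j) := fun v hv =>
    ⟨fun j => ((hker _).1 (hv j)).choose, fun j => ((hker _).1 (hv j)).choose_spec.symm⟩
  -- A cycle of the quotient lifts: the differential of a lift `a` is `x n b`, so `-b` serves as
  -- `inr` part. It is a cycle because `x n` sends its differential to `d (d a) = 0` and `x n` is
  -- injective.
  have extend : ∀ (i : ℕ) (a : KoszulIndex n i → V), (fun j => f (a j)) ∈ koszulZ y n i →
      ∃ v ∈ koszulZ x (n + 1) i, ∀ j, v (inl j) = a j := by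
    intro i a ha
    cases i with
    | zero => exact ⟨fun | inl j => a j, trivial, fun j => rfl⟩
    | succ i =>
      obtain ⟨b, hb⟩ := hlift (koszulD x n i a) (fun j => by
        refine (koszulD_naturality x y f.toAddMonoidHom n hf i a j).symm.trans ?_
        exact congrFun ha j)
      refine ⟨glue a (-b), ?_, fun j => rfl⟩
      change koszulD x (n + 1) i _ = 0
      funext j
      cases j with
      | inl j => simp [koszulD_inl, glue, hb j]
      | @inr _ i j =>
        have h1 : (fun k => (glue a (-b)) (inr k)) = - b := rfl
        rw [koszulD_inr, h1, map_neg, Pi.neg_apply, neg_neg]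
        refine hinj ?_
        rw [← koszulD_operator hx, ← funext hb, koszulD_comp hx]
        simp
  let φ : koszulZ x (n + 1) i →ₗ[A] koszulZ y n i :=
    ((koszulRestrict f n i).comp (koszulZ x (n + 1) i).subtype).codRestrict _
      (fun v => koszulRestrict_mem f n hf hn i v.1 v.2)
  let ψ : koszulZ x (n + 1) i →ₗ[A] KoszulH y n i := (Submodule.mkQ _).comp φ
  have hψ : Function.Surjective ψ := by
    intro z
    obtain ⟨⟨w, hw⟩, rfl⟩ := Submodule.mkQ_surjective _ z
    obtain ⟨a, rfl⟩ := lift w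
    obtain ⟨v, hv, hva⟩ := extend i a hw
    refine ⟨⟨v, hv⟩, congrArg (Submodule.mkQ _) (Subtype.ext (funext fun j => ?_))⟩
    exact congrArg f (hva j)
  have hkerψ : LinearMap.ker ψ =
      (LinearMap.range (koszulD x (n + 1) i)).submoduleOf (koszulZ x (n + 1) i) := by
    ext ⟨v, hv⟩
    rw [LinearMap.mem_ker]
    refine (Submodule.Quotient.mk_eq_zero _).trans ?_
    change koszulRestrict f n i v ∈ LinearMap.range (koszulD y n i) ↔
      v ∈ LinearMap.range (koszulD x (n + 1) i)
    constructor
    · rintro ⟨w, hw⟩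
      obtain ⟨a, rfl⟩ := lift w
      -- A boundary downstairs lifts up to a multiple `x n b`, which the `inr` part `b` of the new
      -- chain absorbs.
      obtain ⟨b, hb⟩ := hlift (fun j => v (inl j) - koszulD x n i a j) (fun j => by
        rw [map_sub, sub_eq_zero]
        have h1 := congrFun hw j
        rw [koszulRestrict_apply] at h1
        rw [← h1]
        exact koszulD_naturality x y f.toAddMonoidHom n hf i a j)
      have hdiff : ∀ j, koszulD x (n + 1) i (glue a b) (inl j) = v (inl j) := by
        intro j
        have := hb j
        simp [koszulD_inl, glue, ← this]
      refine ⟨glue a b, ?_⟩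
      funext j
      cases j with
      | inl j => exact hdiff j
      | @inr _ i j =>
        refine hinj ?_
        -- The difference is a cycle with zero `inl` part, so `x n` kills its `inr` part, and
        -- injectivity makes that part zero.
        have hz : koszulD x (n + 1) i (v - koszulD x (n + 1) (i + 1) (glue a b)) = 0 := by
          rw [map_sub, koszulD_comp hx, sub_zero]
          exact hv
        have := congrFun hz (inl j)
        rw [koszulD_inl] at this
        have h0 : (fun k => (v - koszulD x (n + 1) (i + 1) (glue a b)) (inl k)) = 0 := by
          funext k
          exact sub_eq_zero.2 (hdiff k).symm
        rw [h0, map_zero, Pi.zero_apply, Pi.zero_apply, zero_add, Pi.sub_apply, map_sub,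
          sub_eq_zero] at this
        exact this.symm
    · rintro ⟨w, rfl⟩
      exact ⟨_, koszulD_koszulRestrict f n hf hn i w⟩
  exact ⟨(Submodule.quotEquivOfEq _ _ hkerψ.symm).trans (ψ.quotKerEquivOfSurjective hψ)⟩

end Koszul

/-! ### Koszul complexes in the category of modules and `Tor` -/

section KoszulComplex

variable {R : Type v} [CommRing R] {V : Type v} [AddCommGroup V] [Module R V]

/-- The Koszul complex as a complex of modules. -/
def koszulComplex (x : ℕ → Module.End R V) (hx : ∀ k l v, x k (x l v) = x l (x k v)) (n : ℕ) :
    ChainComplex (ModuleCat.{v} R) ℕ :=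
  ChainComplex.of (fun i => ModuleCat.of R (KoszulIndex n i → V))
    (fun i => ModuleCat.ofHom (koszulD x n i))
    (fun i => ModuleCat.hom_ext (LinearMap.ext fun v => koszulD_comp hx n i v))

variable {x : ℕ → Module.End R V} (hx : ∀ k l v, x k (x l v) = x l (x k v))

theorem koszulComplex_d (n i : ℕ) :
    (koszulComplex x hx n).d (i + 1) i = ModuleCat.ofHom (koszulD x n i) :=
  ChainComplex.of_d (fun i => ModuleCat.of R (KoszulIndex n i → V))
    (fun i => ModuleCat.ofHom (koszulD x n i)) i

/-- In degree zero the outgoing differential of a chain complex is zero, which matches the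
convention that `koszulZ x n 0` is everything. -/
theorem koszulComplex_ker (n i k : ℕ) (hk : (ComplexShape.down ℕ).next i = k) :
    LinearMap.ker ((koszulComplex x hx n).d i k).hom = koszulZ x n i := by
  cases i with
  | zero =>
    have : (koszulComplex x hx n).d 0 k = 0 := (koszulComplex x hx n).shape _ _ (by simp)
    rw [this]
    exact LinearMap.ker_zero
  | succ i =>
    obtain rfl : i = k := by simpa using hk
    rw [koszulComplex_d]
    rfl

theorem koszulComplex_exactAt_iff (n i : ℕ) :
    (koszulComplex x hx n).ExactAt (i + 1) ↔
      ∀ v, koszulD x n i v = 0 → v ∈ LinearMap.range (koszulD x n (i + 1)) := by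
  rw [HomologicalComplex.exactAt_iff' _ (i + 2) (i + 1) i (by simp) (by simp),
    ShortComplex.moduleCat_exact_iff_ker_sub_range]
  change LinearMap.ker ((koszulComplex x hx n).d (i + 1) i).hom ≤
    LinearMap.range ((koszulComplex x hx n).d (i + 2) (i + 1)).hom ↔ _
  rw [koszulComplex_d, koszulComplex_d]
  rfl

/-- The homology of the Koszul complex in the category of modules. -/
theorem nonempty_koszulComplex_homology_equiv (n i : ℕ) :
    Nonempty ((koszulComplex x hx n).homology i ≃ₗ[R] KoszulH x n i) := by
  let C := (koszulComplex x hx n).sc' (i + 1) i ((ComplexShape.down ℕ).next i)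
  let e := (koszulComplex x hx n).homologyIsoSc' (i + 1) i ((ComplexShape.down ℕ).next i)
    (by simp) rfl ≪≫ C.moduleCatHomologyIso
  let z : LinearMap.ker C.g.hom ≃ₗ[R] koszulZ x n i :=
    LinearEquiv.ofEq _ _ (koszulComplex_ker hx n i _ rfl)
  refine ⟨e.toLinearEquiv.trans (Submodule.Quotient.equiv (LinearMap.range C.moduleCatToCycles)
    ((LinearMap.range (koszulD x n i)).submoduleOf (koszulZ x n i)) z ?_)⟩
  ext ⟨v, hv⟩
  rw [Submodule.mem_map]
  change _ ↔ v ∈ LinearMap.range (koszulD x n i)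
  constructor
  · rintro ⟨_, ⟨w, rfl⟩, hw⟩
    have := congrArg Subtype.val hw
    refine ⟨w, ?_⟩
    rw [← show _ = v from this]
    change _ = ((koszulComplex x hx n).d (i + 1) i).hom w
    rw [koszulComplex_d]
    rfl
  · rintro ⟨w, rfl⟩
    refine ⟨_, ⟨w, rfl⟩, Subtype.ext ?_⟩
    change ((koszulComplex x hx n).d (i + 1) i).hom w = _
    rw [koszulComplex_d]
    rfl

end KoszulComplex

/-! ### Tor as Koszul homology. -/

section Tor

variable {R : Type v} [CommRing R] (r : ℕ → R)

/-- The multiplications by a sequence of scalars. -/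
def smulOperator (V : Type*) [AddCommGroup V] [Module R V] (k : ℕ) : Module.End R V :=
  LinearMap.lsmul R V (r k)

theorem smulOperator_comm (V : Type*) [AddCommGroup V] [Module R V] (k l : ℕ) (v : V) :
    smulOperator r V k (smulOperator r V l v) = smulOperator r V l (smulOperator r V k v) :=
  smul_comm (r k) (r l) v

/-- The augmentation of the Koszul complex. -/
def koszulAugmentation (n : ℕ) (Z : ModuleCat.{v} R) (ε : (KoszulIndex n 0 → R) →ₗ[R] Z)
    (hker : LinearMap.range (koszulD (smulOperator r R) n 0) = LinearMap.ker ε) :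
    koszulComplex (smulOperator r R) (smulOperator_comm r R) n ⟶
      (ChainComplex.single₀ (ModuleCat.{v} R)).obj Z :=
  (ChainComplex.toSingle₀Equiv _ _).symm ⟨ModuleCat.ofHom ε, by
    rw [koszulComplex_d]
    refine ModuleCat.hom_ext (LinearMap.ext fun v => ?_)
    exact hker.le ⟨v, rfl⟩⟩

theorem koszulAugmentation_f_zero (n : ℕ) (Z : ModuleCat.{v} R)
    (ε : (KoszulIndex n 0 → R) →ₗ[R] Z)
    (hker : LinearMap.range (koszulD (smulOperator r R) n 0) = LinearMap.ker ε) :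
    (koszulAugmentation r n Z ε hker).f 0 = ModuleCat.ofHom ε :=
  ChainComplex.toSingle₀Equiv_symm_apply_f_zero
    (C := koszulComplex (smulOperator r R) (smulOperator_comm r R) n) (X := Z) (ModuleCat.ofHom ε) _

/-- The projective resolution given by an exact Koszul complex. -/
def koszulResolution (n : ℕ) (Z : ModuleCat.{v} R)
    (hexact : ∀ i v, koszulD (smulOperator r R) n i v = 0 →
      v ∈ LinearMap.range (koszulD (smulOperator r R) n (i + 1)))
    (ε : (KoszulIndex n 0 → R) →ₗ[R] Z) (hε : Function.Surjective ε)
    (hker : LinearMap.range (koszulD (smulOperator r R) n 0) = LinearMap.ker ε) :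
    ProjectiveResolution Z where
  complex := koszulComplex (smulOperator r R) (smulOperator_comm r R) n
  projective i := by
    have : Module.Projective R (KoszulIndex n i → R) := inferInstance
    exact (IsProjective.iff_projective (KoszulIndex n i → R)).1 this
  π := koszulAugmentation r n Z ε hker
  quasiIso := ⟨fun i => by
    cases i with
    | zero =>
      rw [ChainComplex.quasiIsoAt₀_iff, ShortComplex.quasiIso_iff_of_zeros' _ rfl rfl rfl]
      constructor
      · rw [ShortComplex.moduleCat_exact_iff_range_eq_ker]
        change LinearMap.range ((koszulComplex _ _ n).d 1 0).hom =
          LinearMap.ker ((koszulAugmentation r n Z ε hker).f 0).hom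
        rw [koszulAugmentation_f_zero, koszulComplex_d]
        exact hker
      · change Epi ((koszulAugmentation r n Z ε hker).f 0)
        rw [koszulAugmentation_f_zero]
        exact (ModuleCat.epi_iff_surjective _).2 hε
    | succ i =>
      rw [quasiIsoAt_iff_exactAt' (hL := ChainComplex.exactAt_succ_single_obj ..),
        koszulComplex_exactAt_iff]
      exact hexact i⟩

open MonoidalCategory in
/-- Tensoring the Koszul complex of the ring with a module gives that of the module. -/
def koszulTensorIso (n : ℕ) (M : ModuleCat.{v} R) :
    (((tensoringLeft (ModuleCat.{v} R)).obj M).mapHomologicalComplex _).obj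
      (koszulComplex (smulOperator r R) (smulOperator_comm r R) n) ≅
    koszulComplex (smulOperator r M) (smulOperator_comm r M) n :=
  letI := fun i => Fintype.ofFinite (KoszulIndex n i)
  letI := fun i => Classical.decEq (KoszulIndex n i)
  HomologicalComplex.Hom.isoOfComponents
    (fun i => (TensorProduct.piScalarRight R R M (KoszulIndex n i)).toModuleIso)
    (fun i j hij => by
      obtain rfl : j + 1 = i := hij
      rw [koszulComplex_d]
      refine ModuleCat.hom_ext (TensorProduct.ext' fun m v => ?_)
      funext k
      have h1 := koszulD_naturality (smulOperator r R) (smulOperator r M)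
        (LinearMap.toSpanSingleton R M m).toAddMonoidHom n
        (fun k _ s => mul_smul (r k) s m) j v k
      refine (Eq.trans ?_ h1).trans ?_
      · change koszulD (smulOperator r M) n j
          (TensorProduct.piScalarRight R R M _ (TensorProduct.tmul R m v)) k = _
        rfl
      · change _ = TensorProduct.piScalarRight R R M _
          (TensorProduct.tmul R m (((koszulComplex _ _ n).d (j + 1) j).hom v)) k
        rw [koszulComplex_d]
        rfl)

/-- `Tor` against a module that is resolved by a Koszul complex is Koszul homology. -/
theorem nonempty_tor_equiv_koszulH (n : ℕ) (Z M : ModuleCat.{v} R)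
    (hexact : ∀ i v, koszulD (smulOperator r R) n i v = 0 →
      v ∈ LinearMap.range (koszulD (smulOperator r R) n (i + 1)))
    (ε : (KoszulIndex n 0 → R) →ₗ[R] Z) (hε : Function.Surjective ε)
    (hker : LinearMap.range (koszulD (smulOperator r R) n 0) = LinearMap.ker ε) (i : ℕ) :
    Nonempty ((((Tor (ModuleCat.{v} R) i).obj M).obj Z) ≃ₗ[R]
      KoszulH (smulOperator r M) n i) := by
  obtain ⟨e⟩ := nonempty_koszulComplex_homology_equiv (smulOperator_comm r M) n i
  let P := koszulResolution r n Z hexact ε hε hker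
  let e' := P.isoLeftDerivedObj ((MonoidalCategory.tensoringLeft (ModuleCat.{v} R)).obj M) i ≪≫
    (HomologicalComplex.homologyFunctor _ _ i).mapIso (koszulTensorIso r n M)
  exact ⟨e'.toLinearEquiv.trans e⟩

end Tor

/-! ### Betti numbers over a polynomial ring in four variables -/

theorem mem_range_koszulD_smulOperator {R : Type*} [CommRing R] (r : ℕ → R) (n : ℕ)
    (w : KoszulIndex n 0 → R) :
    w ∈ LinearMap.range (koszulD (smulOperator r R) n 0) ↔
      w (base n) ∈ Ideal.span (r '' Set.Iio n) := by
  induction n with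
  | zero =>
    rw [mem_range_koszulD_zero]
    simp
  | succ n ih =>
    have hset : r '' Set.Iio (n + 1) = insert (r n) (r '' Set.Iio n) := by
      rw [← Set.image_insert_eq]
      congr 1
      ext k
      simp only [Set.mem_Iio, Set.mem_insert_iff]
      omega
    rw [mem_range_koszulD_succ, hset, Ideal.mem_span_insert]
    constructor
    · rintro ⟨b, hb⟩
      exact ⟨b, _, (ih _).1 hb, by
        change w (inl (base n)) = b * r n + (w (inl (base n)) - r n * b)
        ring⟩
    · rintro ⟨b, z, hz, hw⟩
      refine ⟨b, (ih _).2 ?_⟩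
      change w (inl (base n)) - r n * b ∈ _
      rwa [show w (inl (base n)) = b * r n + z from hw, mul_comm, add_sub_cancel_left]

section

variable (K : Type u) [Field K]

/-- The variables of `K[x₀, x₁, x₂, x₃]` in the order `x₁, x₂, x₃, x₀`. -/
def rotatedVariable (k : ℕ) : MvPolynomial (Fin 4) K :=
  MvPolynomial.X (Fin.ofNat 4 (k + 1))

theorem rotatedVariable_image (n : ℕ) : rotatedVariable K '' Set.Iio n =
    MvPolynomial.X '' ((fun k => Fin.ofNat 4 (k + 1)) '' Set.Iio n) := by
  rw [Set.image_image]
  rfl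

/-- Membership in an ideal generated by variables is tested monomial by monomial, and multiplying by
a new variable does not change the exponents of the earlier ones. -/
theorem rotatedVariable_regular (m : ℕ) (hm : m < 4) (w : MvPolynomial (Fin 4) K)
    (hw : rotatedVariable K m * w ∈ Ideal.span (rotatedVariable K '' Set.Iio m)) :
    w ∈ Ideal.span (rotatedVariable K '' Set.Iio m) := by
  rw [rotatedVariable_image, MvPolynomial.mem_ideal_span_X_image] at hw ⊢
  intro u hu
  obtain ⟨i, hi, h0⟩ := hw (Finsupp.single (Fin.ofNat 4 (m + 1)) 1 + u) (by
    rw [MvPolynomial.mem_support_iff] at hu ⊢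
    rwa [rotatedVariable, MvPolynomial.coeff_X_mul])
  refine ⟨i, hi, ?_⟩
  obtain ⟨k, hk, rfl⟩ := hi
  have hne : Fin.ofNat 4 (m + 1) ≠ Fin.ofNat 4 (k + 1) := by
    rw [Set.mem_Iio] at hk
    simp only [Fin.ofNat_eq_cast, ne_eq, Fin.ext_iff, Fin.val_natCast]
    omega
  rwa [Finsupp.add_apply, Finsupp.single_eq_of_ne hne.symm, zero_add] at h0

theorem koszulD_rotatedVariable_exact (i : ℕ)
    (v : KoszulIndex 4 (i + 1) → MvPolynomial (Fin 4) K)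
    (hv : koszulD (smulOperator (rotatedVariable K) _) 4 i v = 0) :
    v ∈ LinearMap.range (koszulD (smulOperator (rotatedVariable K) _) 4 (i + 1)) := by
  refine koszulD_exact (smulOperator_comm _ _) 4 (fun m hm w hw => ?_) i v hv
  rw [mem_range_koszulD_smulOperator] at hw ⊢
  exact rotatedVariable_regular K m hm _ hw

/-- The augmentation of the Koszul complex of the variables. -/
def residueAugmentation :
    (KoszulIndex 4 0 → MvPolynomial (Fin 4) K) →ₗ[MvPolynomial (Fin 4) K] residueModule K 4 where
  toFun w := (MvPolynomial.constantCoeff (w (base 4)) : K)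
  map_add' v w := map_add MvPolynomial.constantCoeff (v (base 4)) (w (base 4))
  map_smul' c w := map_mul MvPolynomial.constantCoeff c (w (base 4))

theorem residueAugmentation_surjective : Function.Surjective (residueAugmentation K) := fun c =>
  ⟨fun _ => MvPolynomial.C (σ := Fin 4) (R := K) c, MvPolynomial.constantCoeff_C (Fin 4) (R := K) c⟩

theorem range_koszulD_eq_ker_residueAugmentation :
    LinearMap.range (koszulD (smulOperator (rotatedVariable K) (MvPolynomial (Fin 4) K)) 4 0) =
      LinearMap.ker (residueAugmentation K) := by
  ext w
  have huniv : (fun k => Fin.ofNat 4 (k + 1)) '' Set.Iio 4 = Set.univ := by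
    refine Set.eq_univ_of_forall fun i => ?_
    fin_cases i
    exacts [⟨3, by simp, rfl⟩, ⟨0, by simp, rfl⟩, ⟨1, by simp, rfl⟩, ⟨2, by simp, rfl⟩]
  rw [mem_range_koszulD_smulOperator, rotatedVariable_image, MvPolynomial.mem_ideal_span_X_image,
    huniv, LinearMap.mem_ker]
  change _ ↔ MvPolynomial.constantCoeff (w (base 4)) = 0
  rw [MvPolynomial.constantCoeff_eq, ← MvPolynomial.notMem_support_iff]
  constructor
  · intro h h0
    obtain ⟨i, -, hi⟩ := h _ h0
    exact hi rfl
  · intro h u hu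
    by_contra! hall
    have : u = 0 := Finsupp.ext fun i => hall i (Set.mem_univ i)
    exact h (this ▸ hu)

variable {K}
variable {n : ℕ}

/-- The `K`-vector space underlying a module over `K[x₁, …, xₙ]`. -/
abbrev underlyingSpace (M : ModuleCat.{u} (MvPolynomial (Fin n) K)) : ModuleCat.{u} K :=
  (ModuleCat.restrictScalars (algebraMap K (MvPolynomial (Fin n) K))).obj M

/-- The multiplications by a sequence of polynomials as `K`-linear maps. -/
def underlyingOperator (r : ℕ → MvPolynomial (Fin n) K)
    (M : ModuleCat.{u} (MvPolynomial (Fin n) K)) (k : ℕ) : Module.End K (underlyingSpace M) :=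
  ((ModuleCat.restrictScalars (algebraMap K (MvPolynomial (Fin n) K))).map
    (ModuleCat.ofHom (smulOperator r M k))).hom

/-- The two Koszul complexes have the same underlying functions; only the scalars differ. This
passes from Koszul homology over the polynomial ring to linear algebra over `K`. -/
theorem rank_underlyingSpace_koszulH (r : ℕ → MvPolynomial (Fin n) K)
    (M : ModuleCat.{u} (MvPolynomial (Fin n) K)) (m i : ℕ) :
    Module.rank K (underlyingSpace (ModuleCat.of (MvPolynomial (Fin n) K)
      (KoszulH (smulOperator r M) m i))) =
      Module.rank K (KoszulH (underlyingOperator r M) m i) := by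
  have hd : ∀ i v, koszulD (underlyingOperator r M) m i v = koszulD (smulOperator r M) m i v :=
    fun i v => funext fun j => koszulD_naturality (smulOperator r M) (underlyingOperator r M)
      (AddMonoidHom.id M) m (fun _ _ _ => rfl) i v j
  have hz : ∀ v, v ∈ koszulZ (underlyingOperator r M) m i ↔ v ∈ koszulZ (smulOperator r M) m i := by
    intro v
    cases i with
    | zero => exact Iff.rfl
    | succ i =>
      change koszulD (underlyingOperator r M) m i v = 0 ↔ koszulD (smulOperator r M) m i v = 0
      rw [hd]
      rfl
  let ψ : koszulZ (underlyingOperator r M) m i →ₗ[K]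
      underlyingSpace (ModuleCat.of (MvPolynomial (Fin n) K)
      (KoszulH (smulOperator r M) m i)) :=
    { toFun := fun v => (Submodule.Quotient.mk ⟨v.1, (hz v.1).1 v.2⟩ :
        KoszulH (smulOperator r M) m i)
      map_add' := fun _ _ => rfl
      map_smul' := fun _ _ => rfl }
  have hψ : Function.Surjective ψ := by
    intro z
    obtain ⟨⟨v, hv⟩, rfl⟩ := Submodule.Quotient.mk_surjective _ z
    exact ⟨⟨v, (hz v).2 hv⟩, rfl⟩
  have hker : LinearMap.ker ψ = (LinearMap.range (koszulD (underlyingOperator r M) m i)).submoduleOf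
      (koszulZ (underlyingOperator r M) m i) := by
    ext ⟨v, hv⟩
    rw [LinearMap.mem_ker]
    refine (Submodule.Quotient.mk_eq_zero _).trans ?_
    change (∃ w, koszulD (smulOperator r M) m i w = v) ↔
      (∃ w, koszulD (underlyingOperator r M) m i w = v)
    simp_rw [hd]
    rfl
  exact ((Submodule.quotEquivOfEq _ _ hker.symm).trans
    (ψ.quotKerEquivOfSurjective hψ)).rank_eq.symm

/-- Betti numbers are the dimensions of the homology of the Koszul complex of the variables. -/
theorem bettiNumber_eq_rank_koszulH (M : ModuleCat.{u} (MvPolynomial (Fin 4) K)) (i : ℕ) :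
    bettiNumber M i = Module.rank K (KoszulH (underlyingOperator (rotatedVariable K) M) 4 i) := by
  obtain ⟨e⟩ := nonempty_tor_equiv_koszulH (rotatedVariable K) 4 (residueModule K 4) M
    (koszulD_rotatedVariable_exact K) (residueAugmentation K) (residueAugmentation_surjective K)
    (range_koszulD_eq_ker_residueAugmentation K) i
  rw [← rank_underlyingSpace_koszulH]
  exact ((ModuleCat.restrictScalars (algebraMap K (MvPolynomial (Fin 4) K))).mapIso
    e.toModuleIso).toLinearEquiv.rank_eq

/-- If the first variable is injective on `M`, the Betti numbers of `M` are the dimensions of the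
Koszul homology of the quotient by the first variable. -/
theorem bettiNumber_eq_rank_koszulH_quotient (M : ModuleCat.{u} (MvPolynomial (Fin 4) K))
    {W : Type u} [AddCommGroup W] [Module K W] (y : ℕ → Module.End K W) (f : M →+ W)
    (hC : ∀ (c : K) (m : M), f ((MvPolynomial.C c : MvPolynomial (Fin 4) K) • m) = c • f m)
    (hX : ∀ k < 3, ∀ m : M,
      f ((MvPolynomial.X (Fin.ofNat 4 (k + 1)) : MvPolynomial (Fin 4) K) • m) = y k (f m))
    (hsurj : Function.Surjective f)
    (hinj : ∀ m : M, (MvPolynomial.X 0 : MvPolynomial (Fin 4) K) • m = 0 → m = 0)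
    (hker : ∀ m : M, f m = 0 ↔ ∃ m' : M, (MvPolynomial.X 0 : MvPolynomial (Fin 4) K) • m' = m)
    (i : ℕ) : bettiNumber M i = Module.rank K (KoszulH y 3 i) := by
  rw [bettiNumber_eq_rank_koszulH]
  let g : underlyingSpace M →ₗ[K] W :=
    { toFun := f
      map_add' := map_add f
      map_smul' := hC }
  -- The rotated order makes x₀ the last operator, which is the one that the comparison removes.
  obtain ⟨e⟩ := nonempty_koszulH_equiv (x := underlyingOperator (rotatedVariable K) M) (y := y) (smulOperator_comm (rotatedVariable K) M)
    g 3 hX hsurj ((injective_iff_map_eq_zero _).2 hinj) hker i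
  exact e.rank_eq

end

/-! ### Koszul homology at the two ends -/

section Ends

variable {A V : Type*} [CommRing A] [AddCommGroup V] [Module A V] (x : ℕ → Module.End A V)

namespace KoszulIndex

/-- The one-element subset `{k}` carries the value `f k`. -/
def ofSeq {V : Type*} (f : ℕ → V) : (n : ℕ) → KoszulIndex n 1 → V
  | _ + 1, inl j => ofSeq f _ j
  | n + 1, inr _ => f n

theorem exists_ofSeq {V : Type*} [Nonempty V] (n : ℕ) (v : KoszulIndex n 1 → V) :
    ∃ f : ℕ → V, v = ofSeq f n := by
  -- Only the values below `n` may matter, because the induction fixes the value at `n` afterwards.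
  have key : ∀ (n : ℕ) (v : KoszulIndex n 1 → V),
      ∃ f : ℕ → V, ∀ g : ℕ → V, (∀ k < n, g k = f k) → v = ofSeq g n := by
    intro n
    induction n with
    | zero =>
      intro v
      exact ⟨fun _ => Classical.arbitrary V, fun g _ => funext fun j => nomatch j⟩
    | succ n ih =>
      intro v
      obtain ⟨f, hf⟩ := ih fun j => v (inl j)
      refine ⟨fun k => if k = n then v (inr (base n)) else f k, fun g hg => funext fun j => ?_⟩
      cases j with
      | inl j =>
        refine congrFun (hf g fun k hk => ?_) j
        exact (hg k (by omega)).trans (if_neg (by omega))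
      | inr j =>
        change _ = g n
        rw [eq_base j]
        exact ((hg n (by omega)).trans (if_pos rfl)).symm
  obtain ⟨f, hf⟩ := key n v
  exact ⟨f, hf f fun _ _ => rfl⟩

/-- The index of the full subset. -/
def top : (n : ℕ) → KoszulIndex n n
  | 0 => nil
  | n + 1 => inr (top n)

theorem eq_top : ∀ {n : ℕ} (j : KoszulIndex n n), j = top n
  | 0, nil => rfl
  | n + 1, inl j => absurd j.le (by omega)
  | _ + 1, inr j => congrArg inr (eq_top j)

theorem card (n i : ℕ) : Nat.card (KoszulIndex n i) = n.choose i := by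
  induction n generalizing i with
  | zero =>
    cases i with
    | zero =>
      have : Unique (KoszulIndex 0 0) := ⟨⟨base 0⟩, eq_base⟩
      simp
    | succ i =>
      have := isEmpty_of_lt (show 0 < i + 1 by omega)
      simp
  | succ n ih =>
    cases i with
    | zero =>
      have : Unique (KoszulIndex (n + 1) 0) := ⟨⟨base (n + 1)⟩, eq_base⟩
      simp
    | succ i =>
      let e : KoszulIndex n (i + 1) ⊕ KoszulIndex n i ≃ KoszulIndex (n + 1) (i + 1) :=
        { toFun := Sum.elim inl inr
          invFun := glue Sum.inl Sum.inr
          left_inv := by rintro (j | j) <;> rfl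
          right_inv := by rintro (_ | j | j) <;> rfl }
      rw [← Nat.card_congr e, Nat.card_sum, ih, ih, Nat.choose_succ_succ, add_comm]

end KoszulIndex

theorem koszulD_ofSeq (f : ℕ → V) (n : ℕ) (j : KoszulIndex n 0) :
    koszulD x n 0 (ofSeq f n) j = ∑ k ∈ Finset.range n, x k (f k) := by
  induction n with
  | zero =>
    obtain rfl := eq_base j
    rfl
  | succ n ih =>
    cases j with
    | inl j =>
      rw [koszulD_inl, Finset.sum_range_succ]
      exact congrArg (· + x n (f n)) (ih j)

theorem mem_range_koszulD_iff_exists_sum (n : ℕ) (w : KoszulIndex n 0 → V) :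
    w ∈ LinearMap.range (koszulD x n 0) ↔
      ∃ f : ℕ → V, w (base n) = ∑ k ∈ Finset.range n, x k (f k) := by
  constructor
  · rintro ⟨v, rfl⟩
    obtain ⟨f, rfl⟩ := exists_ofSeq n v
    exact ⟨f, koszulD_ofSeq x f n _⟩
  · rintro ⟨f, hf⟩
    refine ⟨ofSeq f n, funext fun j => ?_⟩
    rw [koszulD_ofSeq, ← hf, eq_base j]

/-- The only top-degree index is the full subset, and the components of the differential of a
top-degree chain are, up to sign, the operators applied to its single value. So top-degree cycles
are the elements killed by all operators. -/
theorem koszulD_eq_zero_iff_top (n : ℕ) (v : KoszulIndex (n + 1) (n + 1) → V) :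
    koszulD x (n + 1) n v = 0 ↔ ∀ k < n + 1, x k (v (top (n + 1))) = 0 := by
  induction n with
  | zero =>
    have h0 : ∀ j, koszulD x 1 0 v j = x 0 (v (top 1)) := by
      intro j
      cases j with
      | inl j =>
        rw [koszulD_inl, eq_base j]
        exact zero_add _
    constructor
    · intro h k hk
      obtain rfl : k = 0 := by omega
      rw [← h0 (base 1), h]
      rfl
    · intro h
      funext j
      rw [h0, h 0 (by omega)]
      rfl
  | succ n ih =>
    have hl : ∀ j, koszulD x (n + 2) (n + 1) v (inl j) = x (n + 1) (v (top (n + 2))) := by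
      intro j
      have h1 : (fun k => v (inl k)) = 0 := funext fun k => absurd k.le (by omega)
      rw [koszulD_inl, h1, map_zero, eq_top j]
      exact zero_add _
    have ih := ih fun k => v (inr k)
    constructor
    · intro h k hk
      rcases Nat.lt_succ_iff_lt_or_eq.1 hk with hk | rfl
      · refine ih.1 (funext fun j => ?_) k hk
        have := congrFun h (inr j)
        rw [koszulD_inr] at this
        exact neg_eq_zero.1 this
      · rw [← hl (top _), h]
        rfl
    · intro h
      funext j
      cases j with
      | inl j =>
        rw [hl, h _ (by omega)]
        rfl
      | inr j =>
        rw [koszulD_inr, ih.2 fun k hk => h k (by omega)]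
        exact neg_zero

end Ends

/-! ### Vanishing above the top degree, and the Euler characteristic. -/

section Euler

variable {K : Type u} [Field K] {V : Type*} [AddCommGroup V] [Module K V]
  {x : ℕ → Module.End K V}

theorem rank_koszulH_of_lt {n i : ℕ} (h : n < i) : Module.rank K (KoszulH x n i) = 0 := by
  have := KoszulIndex.isEmpty_of_lt h
  have : Subsingleton (koszulZ x n i) := inferInstance
  have : Subsingleton (KoszulH x n i) := (Submodule.mkQ_surjective _).subsingleton
  exact rank_subsingleton' K _

variable [Module.Finite K V]

theorem finrank_koszulH_add (hx : ∀ k l v, x k (x l v) = x l (x k v)) (n i : ℕ) :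
    Module.finrank K (KoszulH x n i) + Module.finrank K (LinearMap.range (koszulD x n i)) =
      Module.finrank K (koszulZ x n i) := by
  rw [← Submodule.finrank_quotient_add_finrank
    ((LinearMap.range (koszulD x n i)).submoduleOf (koszulZ x n i)),
    (Submodule.submoduleOfEquivOfLe (range_koszulD_le hx n i)).finrank_eq]

theorem finrank_range_koszulD_add (n i : ℕ) :
    Module.finrank K (LinearMap.range (koszulD x n i)) + Module.finrank K (koszulZ x n (i + 1)) =
      n.choose (i + 1) * Module.finrank K V := by
  have := Fintype.ofFinite (KoszulIndex n (i + 1))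
  refine (LinearMap.finrank_range_add_finrank_ker (koszulD x n i)).trans ?_
  rw [Module.finrank_pi_fintype, Finset.sum_const, Finset.card_univ, ← Nat.card_eq_fintype_card,
    KoszulIndex.card, smul_eq_mul]

/-- The Euler characteristic of the Koszul homology of three operators vanishes. -/
theorem koszulH_euler_three (hx : ∀ k l v, x k (x l v) = x l (x k v)) :
    Module.finrank K (KoszulH x 3 0) + Module.finrank K (KoszulH x 3 2) =
      Module.finrank K (KoszulH x 3 1) + Module.finrank K (KoszulH x 3 3) := by
  have h0 := finrank_koszulH_add hx 3 0
  have h1 := finrank_koszulH_add hx 3 1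
  have h2 := finrank_koszulH_add hx 3 2
  have h3 := finrank_koszulH_add hx 3 3
  have r0 : _ + Module.finrank K (koszulZ x 3 1) = 3 * _ := finrank_range_koszulD_add 3 0
  have r1 : _ + Module.finrank K (koszulZ x 3 2) = 3 * _ := finrank_range_koszulD_add 3 1
  have r2 : _ + Module.finrank K (koszulZ x 3 3) = 1 * _ := finrank_range_koszulD_add 3 2
  -- There are no chains in degree four, so no boundaries in degree three.
  have r3 : _ + _ = 0 * _ := finrank_range_koszulD_add (x := x) 3 3
  have z0 : Module.finrank K (koszulZ x 3 0) = Module.finrank K V := by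
    have := Fintype.ofFinite (KoszulIndex 3 0)
    refine (finrank_top K (KoszulIndex 3 0 → V)).trans ?_
    rw [Module.finrank_pi_fintype, Finset.sum_const, Finset.card_univ, ← Nat.card_eq_fintype_card,
      KoszulIndex.card]
    simp
  omega

end Euler

/-! ### Functions on a staircase of monomials in three variables -/

/-- The exponents of three variables. -/
abbrev Exponent : Type := ℕ × ℕ × ℕ

namespace Exponent

/-- The exponent of a variable. -/
def unit : ℕ → Exponent
  | 0 => (1, 0, 0)
  | 1 => (0, 1, 0)
  | _ => (0, 0, 1)

theorem le_iff (a b : Exponent) : a ≤ b ↔ a.1 ≤ b.1 ∧ a.2.1 ≤ b.2.1 ∧ a.2.2 ≤ b.2.2 := Iff.rfl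

theorem sub_add_cancel {a b : Exponent} (h : a ≤ b) : b - a + a = b := by
  obtain ⟨h1, h2, h3⟩ := h
  exact Prod.ext (Nat.sub_add_cancel h1)
    (Prod.ext (Nat.sub_add_cancel h2) (Nat.sub_add_cancel h3))

theorem add_sub_cancel (a b : Exponent) : a + b - b = a :=
  Prod.ext (Nat.add_sub_cancel ..) (Prod.ext (Nat.add_sub_cancel ..) (Nat.add_sub_cancel ..))

theorem le_add (a b : Exponent) : b ≤ a + b :=
  ⟨Nat.le_add_left .., Nat.le_add_left .., Nat.le_add_left ..⟩

end Exponent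

open Exponent

section Shift

variable (K : Type u) [Field K]

/-- Multiplication by a variable on the functions on exponents. -/
def shift (k : ℕ) : Module.End K (Exponent → K) where
  toFun f u := if unit k ≤ u then f (u - unit k) else 0
  map_add' f g := by
    funext u
    by_cases h : unit k ≤ u <;> simp [h]
  map_smul' c f := by
    funext u
    by_cases h : unit k ≤ u <;> simp [h]

variable {K}

theorem shift_apply (k : ℕ) (f : Exponent → K) (u : Exponent) :
    shift K k f u = if unit k ≤ u then f (u - unit k) else 0 := rfl

theorem shift_apply_add (k : ℕ) (f : Exponent → K) (u : Exponent) :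
    shift K k f (u + unit k) = f u := by
  rw [shift_apply, if_pos (le_add u _), Exponent.add_sub_cancel]

theorem shift_comm (k l : ℕ) (f : Exponent → K) :
    shift K k (shift K l f) = shift K l (shift K k f) := by
  have key : ∀ k l, ∀ u, shift K k (shift K l f) u =
      if unit k + unit l ≤ u then f (u - (unit k + unit l)) else 0 := by
    intro k l u
    simp only [shift_apply]
    generalize unit k = a
    generalize unit l = b
    by_cases h1 : a ≤ u
    · have h2 : b ≤ u - a ↔ a + b ≤ u := by
        simp only [Exponent.le_iff, Prod.fst_add, Prod.snd_add, Prod.fst_sub, Prod.snd_sub] at h1 ⊢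
        omega
      have h3 : u - a - b = u - (a + b) :=
        Prod.ext (Nat.sub_sub ..) (Prod.ext (Nat.sub_sub ..) (Nat.sub_sub ..))
      rw [if_pos h1, h3]
      simp only [h2]
    · have h2 : ¬ a + b ≤ u := by
        simp only [Exponent.le_iff, Prod.fst_add, Prod.snd_add] at h1 ⊢
        omega
      rw [if_neg h1, if_neg h2]
  funext u
  rw [key, key, add_comm]

/-- A function whose support is reached by unit steps from the complement of `T` is a combination
of shifts of functions that vanish on `T`. -/
theorem exists_eq_sum_shift (T : Set Exponent) (m : ℕ) (w : Exponent → K)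
    (hw : ∀ u, w u ≠ 0 → ∃ k < m, unit k ≤ u ∧ u - unit k ∉ T) :
    ∃ f : ℕ → Exponent → K, (∀ k, ∀ v ∈ T, f k v = 0) ∧
      w = ∑ k ∈ Finset.range m, shift K k (f k) := by
  classical
  induction m generalizing w with
  | zero =>
    refine ⟨fun _ _ => 0, fun _ _ _ => rfl, funext fun u => ?_⟩
    by_contra hu
    obtain ⟨k, hk, -⟩ := hw u hu
    omega
  | succ m ih =>
    -- The part of `w` on points reached by the step `unit m` is set aside to become the `m`-th
    -- shift; the induction applies to the rest, which earlier steps reach.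
    obtain ⟨f, hf, hsum⟩ := ih (fun u => if unit m ≤ u ∧ u - unit m ∉ T then 0 else w u) (by
      intro u hu
      by_cases h : unit m ≤ u ∧ u - unit m ∉ T
      · simp [h] at hu
      · rw [if_neg h] at hu
        obtain ⟨k, hk, hk'⟩ := hw u hu
        refine ⟨k, ?_, hk'⟩
        rcases Nat.lt_succ_iff_lt_or_eq.1 hk with hk | rfl
        · exact hk
        · exact absurd hk' h)
    refine ⟨fun k => if k = m then fun v => if v ∈ T then 0 else w (v + unit m) else f k, ?_, ?_⟩
    · intro k v hv
      by_cases hk : k = m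
      · simp [hk, hv]
      · simp [hk, hf k v hv]
    · have : ∑ k ∈ Finset.range m, shift K k
          (if k = m then fun v => if v ∈ T then 0 else w (v + unit m) else f k) =
          ∑ k ∈ Finset.range m, shift K k (f k) :=
        Finset.sum_congr rfl fun k hk => by rw [if_neg (Finset.mem_range.1 hk).ne]
      refine Eq.trans ?_ (Finset.sum_range_succ _ m).symm
      refine Eq.trans ?_ (congrArg₂ (· + ·) this.symm (congrArg (shift K m) (if_pos rfl).symm))
      rw [← hsum]
      funext u
      rw [Pi.add_apply, shift_apply]
      by_cases h1 : unit m ≤ u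
      · by_cases h2 : u - unit m ∈ T
        · simp [h1, h2]
        · simp [h1, h2, Exponent.sub_add_cancel h1]
      · simp [h1]

theorem mem_range_koszulD_shift (m : ℕ) (w : KoszulIndex m 0 → Exponent → K) :
    w ∈ LinearMap.range (koszulD (shift K) m 0) ↔
      ∀ u, (∀ k < m, ¬ unit k ≤ u) → w (base m) u = 0 := by
  rw [mem_range_koszulD_iff_exists_sum]
  constructor
  · rintro ⟨f, hf⟩ u hu
    rw [hf, Finset.sum_apply]
    exact Finset.sum_eq_zero fun k hk => if_neg (hu k (Finset.mem_range.1 hk))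
  · intro h
    obtain ⟨f, -, hf⟩ := exists_eq_sum_shift ∅ m (w (base m)) (by
      intro u hu
      by_contra! hcon
      exact hu (h u fun k hk hku => hcon k hk hku))
    exact ⟨f, hf⟩

/-- Functions on exponents form the power series ring in three variables, with `shift` as
multiplication by a variable; the variables are a regular sequence there. -/
theorem koszulD_shift_exact (i : ℕ) (v : KoszulIndex 3 (i + 1) → Exponent → K)
    (hv : koszulD (shift K) 3 i v = 0) :
    v ∈ LinearMap.range (koszulD (shift K) 3 (i + 1)) := by
  refine koszulD_exact shift_comm 3 (fun m hm w hw => ?_) i v hv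
  rw [mem_range_koszulD_shift] at hw ⊢
  intro u hu
  rw [← shift_apply_add m (w (base m)) u]
  refine hw _ fun k hk hku => hu k hk ?_
  rw [Exponent.le_iff] at hku ⊢
  interval_cases m <;> interval_cases k <;> simpa [unit] using hku

end Shift

/-! ### Koszul homology of a quotient by a monomial ideal. -/

section Staircase

variable (K : Type u) [Field K] (B : Set Exponent)

/-- Restriction of functions on exponents to `B`. -/
def restrictTo : (Exponent → K) →ₗ[K] (B → K) := LinearMap.funLeft K K Subtype.val

/-- Extension of functions on `B` by zero. -/
def extendByZero : (B → K) →ₗ[K] (Exponent → K) := by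
  classical
  exact
  { toFun := fun f u => if h : u ∈ B then f ⟨u, h⟩ else 0
    map_add' := fun f g => by
      funext u
      by_cases h : u ∈ B <;> simp [h]
    map_smul' := fun c f => by
      funext u
      by_cases h : u ∈ B <;> simp [h] }

/-- Multiplication by a variable on the functions on `B`. -/
def staircaseShift (k : ℕ) : Module.End K (B → K) :=
  restrictTo K B ∘ₗ shift K k ∘ₗ extendByZero K B

variable {K B}

theorem restrictTo_apply (f : Exponent → K) (b : B) : restrictTo K B f b = f b := rfl

theorem extendByZero_apply (f : B → K) (b : B) : extendByZero K B f b = f b := dif_pos b.2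

theorem extendByZero_apply_of_notMem (f : B → K) {u : Exponent} (hu : u ∉ B) :
    extendByZero K B f u = 0 := dif_neg hu

theorem restrictTo_extendByZero (f : B → K) : restrictTo K B (extendByZero K B f) = f :=
  funext fun b => extendByZero_apply f b

theorem staircaseShift_apply (k : ℕ) (f : B → K) (b : B) :
    staircaseShift K B k f b =
      if unit k ≤ (b : Exponent) then extendByZero K B f (b - unit k) else 0 := rfl

/-- If `B` is closed under removing a variable, the functions vanishing on `B` are stable under
shifts, like a monomial ideal. The functions on `B` are then the quotient, and restriction is linear
over the variables. -/
theorem restrictTo_shift (hB : ∀ k, ∀ u ∈ B, unit k ≤ u → u - unit k ∈ B) (k : ℕ)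
    (f : Exponent → K) :
    restrictTo K B (shift K k f) = staircaseShift K B k (restrictTo K B f) := by
  funext b
  rw [staircaseShift_apply, restrictTo_apply, shift_apply]
  by_cases h : unit k ≤ (b : Exponent)
  · rw [if_pos h, if_pos h]
    exact (extendByZero_apply (restrictTo K B f) ⟨_, hB k b b.2 h⟩).symm
  · rw [if_neg h, if_neg h]

theorem staircaseShift_comm (hB : ∀ k, ∀ u ∈ B, unit k ≤ u → u - unit k ∈ B) (k l : ℕ)
    (f : B → K) : staircaseShift K B k (staircaseShift K B l f) =
      staircaseShift K B l (staircaseShift K B k f) := by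
  rw [← restrictTo_extendByZero f]
  simp only [← restrictTo_shift hB, shift_comm k l]

theorem koszulD_restrictTo (hB : ∀ k, ∀ u ∈ B, unit k ≤ u → u - unit k ∈ B) (n i : ℕ)
    (v : KoszulIndex n (i + 1) → Exponent → K) (j : KoszulIndex n i) :
    koszulD (staircaseShift K B) n i (fun k => restrictTo K B (v k)) j =
      restrictTo K B (koszulD (shift K) n i v j) :=
  koszulD_naturality (shift K) (staircaseShift K B) (restrictTo K B).toAddMonoidHom n
    (fun k _ f => restrictTo_shift hB k f) i v j

theorem restrictTo_sum_shift (hB : ∀ k, ∀ u ∈ B, unit k ≤ u → u - unit k ∈ B) (n : ℕ)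
    (f : ℕ → Exponent → K) : restrictTo K B (∑ k ∈ Finset.range n, shift K k (f k)) =
      ∑ k ∈ Finset.range n, staircaseShift K B k (restrictTo K B (f k)) := by
  rw [map_sum]
  exact Finset.sum_congr rfl fun k _ => restrictTo_shift hB k _

theorem exists_unit_le {u : Exponent} (hu : u ≠ 0) : ∃ k < 3, unit k ≤ u := by
  obtain ⟨p, q, r⟩ := u
  by_contra! hcon
  have h1 := hcon 0 (by omega)
  have h2 := hcon 1 (by omega)
  have h3 := hcon 2 (by omega)
  simp only [Exponent.le_iff, unit] at h1 h2 h3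
  refine hu (Prod.ext ?_ (Prod.ext ?_ ?_))
  · change p = 0
    omega
  · change q = 0
    omega
  · change r = 0
    omega

theorem not_unit_le_zero (k : ℕ) : ¬ unit k ≤ 0 := by
  match k with
  | 0 => simp [unit]
  | 1 => simp [unit]
  | k + 2 => simp [unit]

/-- Used to compute homology from an explicit surjection on cycles whose kernel is the boundaries.
-/
theorem rank_koszulH_eq {V U : Type u} [AddCommGroup V] [Module K V] [AddCommGroup U] [Module K U]
    {x : ℕ → Module.End K V} {n i : ℕ} (θ : koszulZ x n i →ₗ[K] U) (hθ : Function.Surjective θ)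
    (hker : ∀ v, θ v = 0 ↔ v.1 ∈ LinearMap.range (koszulD x n i)) :
    Module.rank K (KoszulH x n i) = Module.rank K U := by
  have hker : LinearMap.ker θ =
      (LinearMap.range (koszulD x n i)).submoduleOf (koszulZ x n i) := by
    ext v
    exact hker v
  exact ((Submodule.quotEquivOfEq _ _ hker.symm).trans
    (θ.quotKerEquivOfSurjective hθ)).rank_eq

/-- Every nonzero exponent is divisible by a variable, so only the constant coefficient survives
modulo the images of the variables. -/
theorem rank_koszulH_staircase_zero (hB : ∀ k, ∀ u ∈ B, unit k ≤ u → u - unit k ∈ B)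
    (h0 : (0 : Exponent) ∈ B) : Module.rank K (KoszulH (staircaseShift K B) 3 0) = 1 := by
  rw [rank_koszulH_eq (U := K)
    (LinearMap.proj (⟨0, h0⟩ : B) ∘ₗ LinearMap.proj (base 3) ∘ₗ Submodule.subtype _)
    (fun c => ⟨⟨fun _ _ => c, trivial⟩, rfl⟩), Module.rank_self]
  rintro ⟨w, hw⟩
  change w (base 3) ⟨0, h0⟩ = 0 ↔ w ∈ LinearMap.range (koszulD (staircaseShift K B) 3 0)
  rw [mem_range_koszulD_iff_exists_sum]
  constructor
  · intro hw0
    obtain ⟨f, -, hf⟩ := exists_eq_sum_shift ∅ 3 (extendByZero K B (w (base 3))) (by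
      intro u hu
      obtain ⟨k, hk, hku⟩ := exists_unit_le (u := u) (by
        rintro rfl
        exact hu ((extendByZero_apply _ ⟨0, h0⟩).trans hw0))
      exact ⟨k, hk, hku, id⟩)
    refine ⟨fun k => restrictTo K B (f k), ?_⟩
    rw [← restrictTo_sum_shift hB, ← hf, restrictTo_extendByZero]
  · rintro ⟨f, hf⟩
    rw [hf, Finset.sum_apply]
    exact Finset.sum_eq_zero fun k hk => if_neg (not_unit_le_zero k)

theorem exists_ofSeq_eq {V : Type*} (f : ℕ → V) {n k : ℕ} (hk : k < n) :
    ∃ j, ofSeq f n j = f k := by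
  induction n with
  | zero => omega
  | succ n ih =>
    rcases Nat.lt_succ_iff_lt_or_eq.1 hk with hk | rfl
    · obtain ⟨j, hj⟩ := ih hk
      exact ⟨inl j, hj⟩
    · exact ⟨inr (base k), rfl⟩

theorem exists_eq_ofSeq {V : Type*} (f : ℕ → V) {n : ℕ} (j : KoszulIndex n 1) :
    ∃ k, ofSeq f n j = f k := by
  induction n with
  | zero => exact nomatch j
  | succ n ih =>
    cases j with
    | inl j => exact ih j
    | inr j => exact ⟨n, rfl⟩

/-- The coefficient at `g` of a combination of the variables sees the coefficients of the chain only
at points one step below `g`, all of which lie in `B`. So at a minimal element of the complement,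
the differential of a lifted chain does not depend on the lift. -/
theorem koszulD_shift_apply_eq_zero {g : Exponent} (hg : ∀ k, unit k ≤ g → g - unit k ∈ B)
    (v : KoszulIndex 3 1 → Exponent → K) (hv : ∀ j, ∀ u ∈ B, v j u = 0) (j : KoszulIndex 3 0) :
    koszulD (shift K) 3 0 v j g = 0 := by
  obtain ⟨f, rfl⟩ := exists_ofSeq 3 v
  rw [koszulD_ofSeq, Finset.sum_apply]
  refine Finset.sum_eq_zero fun k hk => ?_
  obtain ⟨l, hl⟩ := exists_ofSeq_eq f (Finset.mem_range.1 hk)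
  rw [shift_apply]
  by_cases hle : unit k ≤ g
  · rw [if_pos hle, ← hl]
    exact hv l _ (hg k hle)
  · rw [if_neg hle]

/-- The first Koszul homology of a staircase is freely generated by the minimal elements of the
complement. -/
theorem rank_koszulH_staircase_one (hB : ∀ k, ∀ u ∈ B, unit k ≤ u → u - unit k ∈ B)
    (h0 : (0 : Exponent) ∈ B) (G : Finset Exponent) (hGB : ∀ g ∈ G, g ∉ B)
    (hGmin : ∀ g ∈ G, ∀ k, unit k ≤ g → g - unit k ∈ B)
    (hG : ∀ u ∉ B, u ∉ G → ∃ k < 3, unit k ≤ u ∧ u - unit k ∉ B) :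
    Module.rank K (KoszulH (staircaseShift K B) 3 1) = (G.card : Cardinal.{u}) := by
  have hcycle : ∀ v : KoszulIndex 3 1 → B → K, koszulD (staircaseShift K B) 3 0 v = 0 ↔
      ∀ u ∈ B, koszulD (shift K) 3 0 (fun j => extendByZero K B (v j)) (base 3) u = 0 := by
    intro v
    have := koszulD_restrictTo hB 3 0 (fun j => extendByZero K B (v j)) (base 3)
    simp only [restrictTo_extendByZero] at this
    constructor
    · intro h u hu
      rw [h] at this
      exact (congrFun this ⟨u, hu⟩).symm
    · intro h
      funext j
      rw [eq_base j]
      refine this.trans ?_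
      exact funext fun b => h b b.2
  have hdiff : ∀ (v : KoszulIndex 3 1 → Exponent → K) (g : Exponent), g ∈ G →
      koszulD (shift K) 3 0 (fun j => extendByZero K B (restrictTo K B (v j))) (base 3) g =
        koszulD (shift K) 3 0 v (base 3) g := by
    intro v g hg
    rw [← sub_eq_zero]
    have := koszulD_shift_apply_eq_zero (hGmin g hg)
      ((fun j => extendByZero K B (restrictTo K B (v j))) - v) (fun j u hu => by
        rw [Pi.sub_apply, Pi.sub_apply, sub_eq_zero]
        exact extendByZero_apply (restrictTo K B (v j)) ⟨u, hu⟩) (base 3)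
    rwa [map_sub, Pi.sub_apply, Pi.sub_apply] at this
  -- The differential of a lift of a cycle vanishes on `B`, so it lies in the monomial ideal J of
  -- the complement. Its coefficients at the corners give its class in J/𝔫J, where 𝔫 is generated by
  -- the three variables; this is the connecting map to the minimal generators.
  let θ : koszulZ (staircaseShift K B) 3 1 →ₗ[K] (G → K) :=
    restrictTo K (G : Set Exponent) ∘ₗ LinearMap.proj (base 3) ∘ₗ koszulD (shift K) 3 0 ∘ₗ
      (extendByZero K B).compLeft _ ∘ₗ Submodule.subtype _
  have hθapply : ∀ v g, θ v g =
    koszulD (shift K) 3 0 (fun j => extendByZero K B (v.1 j)) (base 3) g := fun _ _ => rfl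
  rw [rank_koszulH_eq θ]
  · simp
  · intro c
    have hoff : ∀ u ∉ G, extendByZero K (G : Set Exponent) c u = 0 := fun u hu =>
      extendByZero_apply_of_notMem c hu
    obtain ⟨f, -, hf⟩ := exists_eq_sum_shift ∅ 3 (extendByZero K (G : Set Exponent) c) (by
      intro u hu
      obtain ⟨k, hk, hku⟩ := exists_unit_le (u := u) (by
        rintro rfl
        exact hu (hoff _ fun hG0 => hGB _ hG0 h0))
      exact ⟨k, hk, hku, id⟩)
    have hfD : koszulD (shift K) 3 0 (ofSeq f 3) (base 3) =
        extendByZero K (G : Set Exponent) c := by rw [koszulD_ofSeq, hf]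
    refine ⟨⟨fun j => restrictTo K B (ofSeq f 3 j), ?_⟩, funext fun g => ?_⟩
    · change koszulD (staircaseShift K B) 3 0 _ = 0
      funext j
      rw [eq_base j, koszulD_restrictTo hB, hfD]
      exact funext fun b => hoff b fun hbG => hGB b hbG b.2
    · rw [hθapply]
      refine (hdiff (ofSeq f 3) g g.2).trans ?_
      rw [hfD]
      exact extendByZero_apply (B := (G : Set Exponent)) c g
  · rintro ⟨v, hv⟩
    have hv0 := (hcycle v).1 hv
    constructor
    · intro hθv
      -- With all corner coefficients zero, the differential is a combination of the variables with
      -- coefficients vanishing on `B`. Subtracting that chain changes nothing on `B` and leaves a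
      -- cycle of the exact complex upstairs, hence a boundary.
      obtain ⟨f, hfB, hf⟩ := exists_eq_sum_shift B 3
        (koszulD (shift K) 3 0 (fun j => extendByZero K B (v j)) (base 3)) (by
          intro u hu
          refine hG u (fun huB => hu (hv0 u huB)) fun huG => hu ?_
          exact congrFun hθv ⟨u, huG⟩)
      obtain ⟨t, ht⟩ := koszulD_shift_exact 0 ((fun j => extendByZero K B (v j)) - ofSeq f 3) (by
        rw [map_sub, sub_eq_zero]
        funext j
        rw [eq_base j, hf, koszulD_ofSeq])
      refine ⟨fun k => restrictTo K B (t k), funext fun j => ?_⟩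
      rw [koszulD_restrictTo hB, ht, Pi.sub_apply, map_sub, restrictTo_extendByZero]
      obtain ⟨k, hk⟩ := exists_eq_ofSeq f j
      rw [hk, show restrictTo K B (f k) = 0 from funext fun b => hfB k b b.2, sub_zero]
    · rintro ⟨t, rfl⟩
      funext g
      rw [hθapply]
      have h1 := koszulD_restrictTo hB 3 1 (fun j => extendByZero K B (t j))
      simp only [restrictTo_extendByZero] at h1
      simp only [h1]
      rw [hdiff _ g g.2, koszulD_comp shift_comm]
      rfl

/-- The last Koszul homology of a staircase is freely generated by its maximal elements. -/
theorem rank_koszulH_staircase_three (M : Finset Exponent) (hMB : ∀ m ∈ M, m ∈ B)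
    (hMmax : ∀ m ∈ M, ∀ k, m + unit k ∉ B)
    (hM : ∀ u ∈ B, u ∉ M → ∃ k < 3, u + unit k ∈ B) :
    Module.rank K (KoszulH (staircaseShift K B) 3 3) = (M.card : Cardinal.{u}) := by
  classical
  let θ : koszulZ (staircaseShift K B) 3 3 →ₗ[K] (M → K) :=
    LinearMap.funLeft K K (fun m : M => (⟨m, hMB m m.2⟩ : B)) ∘ₗ LinearMap.proj (top 3) ∘ₗ
      Submodule.subtype _
  -- There are no boundaries in top degree, so the homology is the socle, and `θ` reads off its
  -- values at the maximal points.
  have hempty := isEmpty_of_lt (show 3 < 4 by omega)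
  rw [rank_koszulH_eq θ]
  · simp
  · intro c
    refine ⟨⟨fun _ b => if hb : (b : Exponent) ∈ M then c ⟨b, hb⟩ else 0, ?_⟩, funext fun m => ?_⟩
    · change koszulD (staircaseShift K B) 3 2 _ = 0
      rw [koszulD_eq_zero_iff_top]
      intro k _
      funext b
      rw [staircaseShift_apply]
      split_ifs with hle
      · by_cases hb : (b : Exponent) - unit k ∈ B
        · refine (extendByZero_apply _ ⟨_, hb⟩).trans (dif_neg fun hbM => ?_)
          refine hMmax _ hbM k ?_
          rw [Exponent.sub_add_cancel hle]
          exact b.2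
        · exact extendByZero_apply_of_notMem _ hb
      · rfl
    · exact dif_pos m.2
  · rintro ⟨v, hv⟩
    constructor
    · intro hθv
      have htop := (koszulD_eq_zero_iff_top _ 2 v).1 hv
      have hv0 : v = 0 := by
        funext j b
        rw [eq_top j]
        by_cases hb : (b : Exponent) ∈ M
        · exact congrFun hθv ⟨b, hb⟩
        -- Away from the maximal points some variable moves `b` inside `B`, so being killed by that
        -- variable forces the value at `b` to be zero.
        · obtain ⟨k, hk, hkB⟩ := hM b b.2 hb
          have := congrFun (htop k hk) ⟨_, hkB⟩
          rw [staircaseShift_apply, if_pos (le_add _ _)] at this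
          simp only [Exponent.add_sub_cancel] at this
          exact (extendByZero_apply _ b).symm.trans this
      subst hv0
      exact zero_mem _
    · rintro ⟨t, ht⟩
      have hv0 : v = 0 := ht.symm.trans (by rw [Subsingleton.elim t 0, map_zero])
      exact (congrArg θ (Subtype.ext hv0)).trans (map_zero θ)

end Staircase

/-! ### The staircase of the Arslan semigroups -/

/-- The exponents of the monomials in `x₁, x₂, x₃` outside of the ideal
`(x₁ x₂, (x₂, x₃) ^ h, x₁ ^ 2 (x₁, x₃) ^ (h - 1))`. -/
def arslanStaircase (h : ℕ) : Set Exponent :=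
  {u | (u.1 = 0 ∧ u.2.1 + u.2.2 < h) ∨ (1 ≤ u.1 ∧ u.2.1 = 0 ∧ u.1 + u.2.2 ≤ h)}

/-- The minimal elements of the complement of the staircase. -/
def arslanCorners (h : ℕ) : Finset Exponent :=
  ({(1, 1, 0)} ∪ (Finset.HasAntidiagonal.antidiagonal h).image fun x => (0, x.1, x.2)) ∪
    (Finset.HasAntidiagonal.antidiagonal (h - 1)).image fun x => (x.1 + 2, 0, x.2)

/-- The maximal elements of the staircase. -/
def arslanTops (h : ℕ) : Finset Exponent :=
  ((Finset.HasAntidiagonal.antidiagonal (h - 2)).image fun x => (0, x.1 + 1, x.2)) ∪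
    (Finset.HasAntidiagonal.antidiagonal (h - 1)).image fun x => (x.1 + 1, 0, x.2)

theorem mem_arslanStaircase {h p q r : ℕ} : (p, q, r) ∈ arslanStaircase h ↔
    (p = 0 ∧ q + r < h) ∨ (1 ≤ p ∧ q = 0 ∧ p + r ≤ h) := Iff.rfl

theorem mem_arslanCorners {h : ℕ} (hh : 2 ≤ h) {p q r : ℕ} : (p, q, r) ∈ arslanCorners h ↔
    (p = 1 ∧ q = 1 ∧ r = 0) ∨ (p = 0 ∧ q + r = h) ∨ (2 ≤ p ∧ q = 0 ∧ p + r = h + 1) := by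
  simp only [arslanCorners, Finset.mem_union, Finset.mem_singleton, Finset.mem_image,
    Finset.HasAntidiagonal.mem_antidiagonal, Prod.mk.injEq, Prod.exists]
  constructor
  · rintro ((h1 | ⟨a, b, h1, h2⟩) | ⟨a, b, h1, h2⟩)
    all_goals omega
  · rintro (h1 | h1 | h1)
    · exact Or.inl (Or.inl h1)
    · exact Or.inl (Or.inr ⟨q, r, by omega⟩)
    · exact Or.inr ⟨p - 2, r, by omega⟩

theorem mem_arslanTops {h : ℕ} (hh : 2 ≤ h) {p q r : ℕ} : (p, q, r) ∈ arslanTops h ↔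
    (p = 0 ∧ 1 ≤ q ∧ q + r + 1 = h) ∨ (1 ≤ p ∧ q = 0 ∧ p + r = h) := by
  simp only [arslanTops, Finset.mem_union, Finset.mem_image,
    Finset.HasAntidiagonal.mem_antidiagonal, Prod.mk.injEq, Prod.exists]
  constructor
  · rintro (⟨a, b, h1, h2⟩ | ⟨a, b, h1, h2⟩)
    all_goals omega
  · rintro (h1 | h1)
    · exact Or.inl ⟨q - 1, r, by omega⟩
    · exact Or.inr ⟨p - 1, r, by omega⟩

theorem card_arslanCorners {h : ℕ} (hh : 2 ≤ h) : (arslanCorners h).card = 2 * h + 2 := by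
  rw [arslanCorners, Finset.card_union_of_disjoint, Finset.card_union_of_disjoint,
    Finset.card_image_of_injective, Finset.card_image_of_injective, Finset.card_singleton,
    Finset.Nat.card_antidiagonal, Finset.Nat.card_antidiagonal]
  · omega
  · rintro ⟨a, b⟩ ⟨c, d⟩ h1
    simp only [Prod.mk.injEq] at h1 ⊢
    omega
  · rintro ⟨a, b⟩ ⟨c, d⟩ h1
    simp only [Prod.mk.injEq] at h1 ⊢
    omega
  · rw [Finset.disjoint_left]
    rintro ⟨p, q, r⟩ h1 h2
    simp only [Finset.mem_singleton, Finset.mem_image, Prod.mk.injEq, Prod.exists] at h1 h2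
    obtain ⟨a, b, -, h2⟩ := h2
    omega
  · rw [Finset.disjoint_left]
    rintro ⟨p, q, r⟩ h1 h2
    simp only [Finset.mem_union, Finset.mem_singleton, Finset.mem_image, Prod.mk.injEq,
      Prod.exists] at h1 h2
    obtain ⟨a, b, -, h2⟩ := h2
    rcases h1 with h1 | ⟨c, d, -, h1⟩ <;> omega

theorem card_arslanTops {h : ℕ} (hh : 2 ≤ h) : (arslanTops h).card = 2 * h - 1 := by
  rw [arslanTops, Finset.card_union_of_disjoint,
    Finset.card_image_of_injective, Finset.card_image_of_injective,
    Finset.Nat.card_antidiagonal, Finset.Nat.card_antidiagonal]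
  · omega
  · rintro ⟨a, b⟩ ⟨c, d⟩ h1
    simp only [Prod.mk.injEq] at h1 ⊢
    omega
  · rintro ⟨a, b⟩ ⟨c, d⟩ h1
    simp only [Prod.mk.injEq] at h1 ⊢
    omega
  · rw [Finset.disjoint_left]
    rintro ⟨p, q, r⟩ h1 h2
    simp only [Finset.mem_image, Prod.mk.injEq, Prod.exists] at h1 h2
    obtain ⟨a, b, -, h2⟩ := h2
    obtain ⟨c, d, -, h1⟩ := h1
    omega

theorem finite_arslanStaircase (h : ℕ) : Finite (arslanStaircase h) := by
  refine ((Set.finite_Iic ((h, h, h) : Exponent)).subset ?_).to_subtype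
  rintro ⟨p, q, r⟩ hu
  rw [mem_arslanStaircase] at hu
  refine ⟨?_, ?_, ?_⟩ <;> simp only <;> omega

theorem sub_unit_mem_arslanStaircase (h k : ℕ) (u : Exponent) (hu : u ∈ arslanStaircase h)
    (hk : unit k ≤ u) : u - unit k ∈ arslanStaircase h := by
  obtain ⟨p, q, r⟩ := u
  match k with
  | 0 =>
    simp only [unit, Exponent.le_iff, Prod.mk_sub_mk, mem_arslanStaircase] at *
    omega
  | 1 =>
    simp only [unit, Exponent.le_iff, Prod.mk_sub_mk, mem_arslanStaircase] at *
    omega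
  | k + 2 =>
    simp only [unit, Exponent.le_iff, Prod.mk_sub_mk, mem_arslanStaircase] at *
    omega

theorem arslanCorners_spec {h : ℕ} (hh : 2 ≤ h) :
    (∀ g ∈ arslanCorners h, g ∉ arslanStaircase h) ∧
    (∀ g ∈ arslanCorners h, ∀ k, unit k ≤ g → g - unit k ∈ arslanStaircase h) ∧
    (∀ u ∉ arslanStaircase h, u ∉ arslanCorners h →
      ∃ k < 3, unit k ≤ u ∧ u - unit k ∉ arslanStaircase h) := by
  refine ⟨?_, ?_, ?_⟩
  · rintro ⟨p, q, r⟩ hu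
    rw [mem_arslanCorners hh] at hu
    rw [mem_arslanStaircase]
    omega
  · rintro ⟨p, q, r⟩ hu k hk
    rw [mem_arslanCorners hh] at hu
    match k with
    | 0 =>
      simp only [unit, Exponent.le_iff, Prod.mk_sub_mk, mem_arslanStaircase] at *
      omega
    | 1 =>
      simp only [unit, Exponent.le_iff, Prod.mk_sub_mk, mem_arslanStaircase] at *
      omega
    | k + 2 =>
      simp only [unit, Exponent.le_iff, Prod.mk_sub_mk, mem_arslanStaircase] at *
      omega
  · rintro ⟨p, q, r⟩ hu hc
    rw [mem_arslanCorners hh] at hc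
    rw [mem_arslanStaircase] at hu
    by_contra! hcon
    have h0 := hcon 0 (by omega)
    have h1 := hcon 1 (by omega)
    have h2 := hcon 2 (by omega)
    simp only [unit, Exponent.le_iff, Prod.mk_sub_mk, mem_arslanStaircase] at h0 h1 h2
    omega

theorem arslanTops_spec {h : ℕ} (hh : 2 ≤ h) :
    (∀ m ∈ arslanTops h, m ∈ arslanStaircase h) ∧
    (∀ m ∈ arslanTops h, ∀ k, m + unit k ∉ arslanStaircase h) ∧
    (∀ u ∈ arslanStaircase h, u ∉ arslanTops h →
      ∃ k < 3, u + unit k ∈ arslanStaircase h) := by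
  refine ⟨?_, ?_, ?_⟩
  · rintro ⟨p, q, r⟩ hu
    rw [mem_arslanTops hh] at hu
    rw [mem_arslanStaircase]
    omega
  · rintro ⟨p, q, r⟩ hu k
    rw [mem_arslanTops hh] at hu
    match k with
    | 0 =>
      simp only [unit, Prod.mk_add_mk, mem_arslanStaircase] at *
      omega
    | 1 =>
      simp only [unit, Prod.mk_add_mk, mem_arslanStaircase] at *
      omega
    | k + 2 =>
      simp only [unit, Prod.mk_add_mk, mem_arslanStaircase] at *
      omega
  · rintro ⟨p, q, r⟩ hu hc
    rw [mem_arslanTops hh] at hc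
    rw [mem_arslanStaircase] at hu
    by_contra! hcon
    have h0 := hcon 0 (by omega)
    have h1 := hcon 1 (by omega)
    have h2 := hcon 2 (by omega)
    simp only [unit, Prod.mk_add_mk, mem_arslanStaircase] at h0 h1 h2
    omega

theorem rank_koszulH_arslanStaircase (K : Type u) [Field K] {h : ℕ} (hh : 2 ≤ h) (i : ℕ) :
    Module.rank K (KoszulH (staircaseShift K (arslanStaircase h)) 3 i) =
      (([1, 2 * h + 2, 4 * h, 2 * h - 1].getD i 0 : ℕ) : Cardinal.{u}) := by
  have hB : ∀ k, ∀ u ∈ arslanStaircase h, unit k ≤ u → u - unit k ∈ arslanStaircase h :=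
    sub_unit_mem_arslanStaircase h
  have h0 : (0 : Exponent) ∈ arslanStaircase h := Or.inl ⟨rfl, by change 0 + 0 < h; omega⟩
  obtain ⟨c1, c2, c3⟩ := arslanCorners_spec hh
  obtain ⟨t1, t2, t3⟩ := arslanTops_spec hh
  have r0 := rank_koszulH_staircase_zero (K := K) hB h0
  have r1 := rank_koszulH_staircase_one (K := K) hB h0 _ c1 c2 c3
  have r3 := rank_koszulH_staircase_three (K := K) _ t1 t2 t3
  rw [card_arslanCorners hh] at r1
  rw [card_arslanTops hh] at r3
  match i with
  | 0 => simpa using r0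
  | 1 => simpa using r1
  | 2 =>
    -- The Euler characteristic needs a finite-dimensional space, hence a finite staircase; it then
    -- gives the middle rank as (2h + 2) + (2h - 1) - 1.
    have := finite_arslanStaircase h
    have e := koszulH_euler_three (staircaseShift_comm (K := K) hB)
    rw [Module.finrank_eq_of_rank_eq (n := 1) (by simpa using r0),
      Module.finrank_eq_of_rank_eq r1, Module.finrank_eq_of_rank_eq r3] at e
    rw [← Module.finrank_eq_rank]
    congr 1
    change _ = 4 * h
    omega
  | 3 => simpa using r3
  | i + 4 => simpa using rank_koszulH_of_lt (show 3 < i + 4 by omega)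

/-- If the first variable is injective on `M` with quotient the functions on the staircase, then
`M` has the Betti sequence of the Arslan semigroups. -/
theorem hasBettiSequence_of_arslanStaircase {K : Type u} [Field K] {h : ℕ} (hh : 2 ≤ h)
    (M : ModuleCat.{u} (MvPolynomial (Fin 4) K)) (f : M →+ (arslanStaircase h → K))
    (hC : ∀ (c : K) (m : M), f ((MvPolynomial.C c : MvPolynomial (Fin 4) K) • m) = c • f m)
    (hX : ∀ k < 3, ∀ m : M,
      f ((MvPolynomial.X (Fin.ofNat 4 (k + 1)) : MvPolynomial (Fin 4) K) • m) =
        staircaseShift K (arslanStaircase h) k (f m))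
    (hsurj : Function.Surjective f)
    (hinj : ∀ m : M, (MvPolynomial.X 0 : MvPolynomial (Fin 4) K) • m = 0 → m = 0)
    (hker : ∀ m : M, f m = 0 ↔ ∃ m' : M, (MvPolynomial.X 0 : MvPolynomial (Fin 4) K) • m' = m) :
    HasBettiSequence M [1, 2 * h + 2, 4 * h, 2 * h - 1] := fun i => by
  rw [bettiNumber_eq_rank_koszulH_quotient M _ f hC hX hsurj hinj hker i,
    rank_koszulH_arslanStaircase K hh]

/-! ### Factorizations in the Arslan semigroups -/

namespace Exponent

/-- The total degree. -/
def degree (u : Exponent) : ℕ := u.1 + u.2.1 + u.2.2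

end Exponent

/-- The element of the Arslan semigroup with the given multiplicities of the last three
generators. -/
def arslanEval (h : ℕ) (u : Exponent) : ℕ :=
  u.1 * (h * (h + 1) + 1) + u.2.1 * (h + 1) ^ 2 + u.2.2 * ((h + 1) ^ 2 + 1)

theorem arslanEval_add (h : ℕ) (u v : Exponent) :
    arslanEval h (u + v) = arslanEval h u + arslanEval h v := by
  simp only [arslanEval, Prod.fst_add, Prod.snd_add]
  ring

theorem degree_add (u v : Exponent) : degree (u + v) = degree u + degree v := by
  simp only [degree, Prod.fst_add, Prod.snd_add]
  ring

theorem degree_unit (k : ℕ) : degree (unit k) = 1 := by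
  match k with
  | 0 => rfl
  | 1 => rfl
  | k + 2 => rfl

theorem arslanEval_unit (h : ℕ) {k : ℕ} (hk : k < 3) :
    arslanEval h (unit k) = arslanGen h (Fin.ofNat 4 (k + 1)) := by
  interval_cases k
  · change arslanEval h (1, 0, 0) = h * (h + 1) + 1
    simp [arslanEval]
  · change arslanEval h (0, 1, 0) = (h + 1) ^ 2
    simp [arslanEval]
  · change arslanEval h (0, 0, 1) = (h + 1) ^ 2 + 1
    simp [arslanEval]

/-- A point of the staircase is the only factorization of its value. -/
theorem eq_of_mem_arslanStaircase {h : ℕ} {u : Exponent} (hu : u ∈ arslanStaircase h)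
    {a : ℕ} {v : Exponent} (heq : arslanEval h u = a * (h * (h + 1)) + arslanEval h v) :
    a = 0 ∧ v = u := by
  obtain ⟨p, q, r⟩ := u
  obtain ⟨p', q', r'⟩ := v
  rw [mem_arslanStaircase] at hu
  simp only [arslanEval] at heq
  have hj : p + r ≤ h := by omega
  have he : q + r < h := by omega
  -- The value is arranged so that its residue modulo `h + 1` is read from `p + r`, which is at most
  -- `h` on the staircase; the quotient is then treated in the same way modulo `h`, where `q + r <
  -- h` determines the residue.
  have hval : (h + 1) * (p * h + (q + r) * (h + 1)) + (p + r) =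
      (h + 1) * ((a + p') * h + (q' + r') * (h + 1)) + (p' + r') := by
    linear_combination heq
  have hmod : p + r = (p' + r') % (h + 1) := by
    have := congrArg (· % (h + 1)) hval
    simp only [Nat.mul_add_mod] at this
    rwa [Nat.mod_eq_of_lt (by omega)] at this
  obtain ⟨m, hm⟩ : ∃ m, p' + r' = (p + r) + (h + 1) * m :=
    ⟨(p' + r') / (h + 1), by rw [hmod, Nat.mod_add_div]⟩
  have hval2 : h * (p + (q + r)) + (q + r) = h * ((a + p') + (q' + r')) + (q' + r' + m) := by
    have : (h + 1) * (p * h + (q + r) * (h + 1)) =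
        (h + 1) * ((a + p') * h + (q' + r') * (h + 1) + m) := by
      rw [hm] at hval
      linear_combination hval
    have := Nat.eq_of_mul_eq_mul_left (Nat.succ_pos h) this
    linear_combination this
  have hmod2 : q + r = (q' + r' + m) % h := by
    have := congrArg (· % h) hval2
    simp only [Nat.mul_add_mod] at this
    rwa [Nat.mod_eq_of_lt he] at this
  obtain ⟨l, hl⟩ : ∃ l, q' + r' + m = (q + r) + h * l :=
    ⟨(q' + r' + m) / h, by rw [hmod2, Nat.mod_add_div]⟩
  have hsum : p + (q + r) = (a + p') + (q' + r') + l := by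
    rw [hl] at hval2
    refine Nat.eq_of_mul_eq_mul_left (show 0 < h by omega) ?_
    linear_combination hval2
  -- A positive `m` makes `p' + r'` exceed `p + r` by more than `h`; as `hsum` bounds it by `p + q +
  -- r`, this would force `q > h`.
  have hm0 : m = 0 := by
    rcases Nat.eq_zero_or_pos m with hm0 | hm0
    · exact hm0
    · have : (h + 1) * 1 ≤ (h + 1) * m := Nat.mul_le_mul_left _ hm0
      omega
  subst hm0
  -- A positive `l` makes `q' + r'` exceed `q + r` by at least `h`, and with the summand `l` in
  -- `hsum` this would force `p > h`. Once `m` and `l` vanish, the three linear relations determine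
  -- everything because `p` or `q` is zero.
  have hl0 : l = 0 := by
    rcases Nat.eq_zero_or_pos l with hl0 | hl0
    · exact hl0
    · have : h * 1 ≤ h * l := Nat.mul_le_mul_left _ hl0
      omega
  subst hl0
  simp only [Prod.mk.injEq]
  omega

theorem arslanEval_injOn (h : ℕ) : Set.InjOn (arslanEval h) (arslanStaircase h) :=
  fun u _ v hv huv => (eq_of_mem_arslanStaircase hv (a := 0) (by rw [zero_mul, zero_add, huv])).2

/-- Outside of the staircase there is a factorization that involves the first generator and is at
least as long. -/
theorem exists_factorization_of_notMem {h : ℕ} (hh : 2 ≤ h) {u : Exponent}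
    (hu : u ∉ arslanStaircase h) : ∃ a v, arslanEval h u = (a + 1) * (h * (h + 1)) + arslanEval h v ∧
      degree u ≤ a + 1 + degree v := by
  obtain ⟨p, q, r⟩ := u
  rw [mem_arslanStaircase] at hu
  simp only [arslanEval, degree]
  -- The relation x₁x₂ → x₀x₃ preserves length.
  by_cases h1 : 1 ≤ p ∧ 1 ≤ q
  · obtain ⟨p, rfl⟩ : ∃ p', p = p' + 1 := ⟨p - 1, by omega⟩
    obtain ⟨q, rfl⟩ : ∃ q', q = q' + 1 := ⟨q - 1, by omega⟩
    exact ⟨0, (p, q, r + 1), by ring, by simp only; omega⟩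
  -- With i + k = h, the relation x₂ᵏx₃ⁱ → x₀ᵏ⁺¹x₁ⁱ gains one in length; `i` is taken as large as
  -- `r` and `h` allow.
  by_cases h2 : h ≤ q + r
  · obtain ⟨i, k, q', r', hik, rfl, rfl⟩ :
        ∃ i k q' r', i + k = h ∧ q = q' + k ∧ r = r' + i :=
      ⟨min r h, h - min r h, q - (h - min r h), r - min r h, by omega, by omega, by omega⟩
    refine ⟨k, (p + i, q', r'), ?_, by simp only; omega⟩
    subst hik
    ring
  -- Here `q = 0` and `p + r > h`. With k = h - r - 1, the relation x₁ᵏ⁺²x₃ʳ → x₀ᵏ⁺¹x₂ʳ⁺¹ preserves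
  -- length and uses up all of x₃.
  · obtain ⟨k, hk⟩ : ∃ k, h = r + k + 1 := ⟨h - r - 1, by omega⟩
    obtain ⟨p', rfl⟩ : ∃ p', p = p' + (k + 2) := ⟨p - (k + 2), by omega⟩
    obtain rfl : q = 0 := by omega
    refine ⟨k, (p', r + 1, 0), ?_, by simp only; omega⟩
    subst hk
    ring

/-- The elements of the Arslan semigroup with a factorization of length at least `k`. -/
def arslanLevel (h k : ℕ) : Set ℕ :=
  {s | ∃ a v, s = a * (h * (h + 1)) + arslanEval h v ∧ k ≤ a + degree v}

theorem add_mem_arslanLevel {h i j s t : ℕ} (hs : s ∈ arslanLevel h i) (ht : t ∈ arslanLevel h j) :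
    s + t ∈ arslanLevel h (i + j) := by
  obtain ⟨a, u, rfl, hu⟩ := hs
  obtain ⟨b, v, rfl, hv⟩ := ht
  refine ⟨a + b, u + v, ?_, ?_⟩
  · rw [arslanEval_add]
    ring
  · rw [degree_add]
    omega

theorem arslanLevel_anti {h i j : ℕ} (hij : i ≤ j) : arslanLevel h j ⊆ arslanLevel h i := by
  rintro _ ⟨a, u, rfl, hu⟩
  exact ⟨a, u, rfl, by omega⟩

theorem arslanGen_mem_level (h : ℕ) (i : Fin 4) : arslanGen h i ∈ arslanLevel h 1 := by
  fin_cases i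
  · exact ⟨1, 0, by simp [arslanGen, arslanEval], by simp⟩
  · exact ⟨0, (1, 0, 0), by simp [arslanGen, arslanEval], by simp [degree]⟩
  · exact ⟨0, (0, 1, 0), by simp [arslanGen, arslanEval], by simp [degree]⟩
  · exact ⟨0, (0, 0, 1), by simp [arslanGen, arslanEval], by simp [degree]⟩

theorem zero_mem_arslanLevel (h : ℕ) : 0 ∈ arslanLevel h 0 := ⟨0, 0, by simp [arslanEval], by simp⟩

theorem eval_mem_generatedSemigroup (h a : ℕ) (v : Exponent) :
    a * (h * (h + 1)) + arslanEval h v ∈ generatedSemigroup (arslanGen h) := by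
  have key : ∀ (n : ℕ) (i : Fin 4), n * arslanGen h i ∈ generatedSemigroup (arslanGen h) :=
    fun n i => by
      rw [← smul_eq_mul]
      exact AddSubmonoid.nsmul_mem _ (gen_mem_generatedSemigroup _ i) n
  exact add_mem (key a 0) (add_mem (add_mem (key v.1 1) (key v.2.1 2)) (key v.2.2 3))

theorem mem_generatedSemigroup_iff {h s : ℕ} :
    s ∈ generatedSemigroup (arslanGen h) ↔ s ∈ arslanLevel h 0 := by
  constructor
  · intro hs
    induction hs using AddSubmonoid.closure_induction with
    | mem x hx =>
      obtain ⟨i, rfl⟩ := hx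
      exact arslanLevel_anti (Nat.zero_le 1) (arslanGen_mem_level h i)
    | zero => exact zero_mem_arslanLevel h
    | add x y _ _ hx hy => exact add_mem_arslanLevel hx hy
  · rintro ⟨a, v, rfl, -⟩
    exact eval_mem_generatedSemigroup h a v

theorem mem_arslanLevel_one {h s : ℕ} (hs : s ∈ arslanLevel h 0) (h0 : s ≠ 0) :
    s ∈ arslanLevel h 1 := by
  obtain ⟨a, ⟨p, q, r⟩, rfl, -⟩ := hs
  refine ⟨a, _, rfl, ?_⟩
  by_contra! hlt
  simp only [degree] at hlt
  obtain ⟨rfl, rfl, rfl, rfl⟩ : a = 0 ∧ p = 0 ∧ q = 0 ∧ r = 0 := by omega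
  exact h0 (by simp [arslanEval])

/-- An element of level `k` is the value of a point of the staircase of degree at least `k`, or
the first generator can be split off. -/
theorem mem_arslanLevel_cases {h : ℕ} (hh : 2 ≤ h) {s k : ℕ} (hs : s ∈ arslanLevel h k) :
    (∃ b ∈ arslanStaircase h, s = arslanEval h b ∧ k ≤ degree b) ∨
      ∃ t ∈ arslanLevel h (k - 1), s = t + h * (h + 1) := by
  obtain ⟨a, v, rfl, hk⟩ := hs
  cases a with
  | zero =>
    by_cases hv : v ∈ arslanStaircase h
    · exact Or.inl ⟨v, hv, by simp, by omega⟩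
    · obtain ⟨a, w, hw, hdeg⟩ := exists_factorization_of_notMem hh hv
      refine Or.inr ⟨a * (h * (h + 1)) + arslanEval h w, ⟨a, w, rfl, by omega⟩, ?_⟩
      rw [hw]
      ring
  | succ a =>
    refine Or.inr ⟨a * (h * (h + 1)) + arslanEval h v, ⟨a, v, rfl, by omega⟩, ?_⟩
    ring

/-- Splitting off the first generator would give a second factorization of a staircase value.
Together with `mem_arslanLevel_cases` this identifies the staircase values with the Apéry set of the
first generator. -/
theorem eval_ne_add_of_mem_level {h : ℕ} {b : Exponent} (hb : b ∈ arslanStaircase h) {s : ℕ}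
    (hs : s ∈ arslanLevel h 0) : arslanEval h b ≠ s + h * (h + 1) := by
  obtain ⟨a, v, rfl, -⟩ := hs
  intro heq
  have := eq_of_mem_arslanStaircase hb (a := a + 1) (v := v) (by rw [heq]; ring)
  omega

/-- By uniqueness of the factorization, a generator that can be subtracted from a staircase value
inside the semigroup already divides the monomial. This is why the quotient by x₀ is a monomial
quotient. -/
theorem unit_le_of_eval_eq {h : ℕ} {b : Exponent} (hb : b ∈ arslanStaircase h) {s k : ℕ}
    (hs : s ∈ arslanLevel h 0) (heq : arslanEval h b = s + arslanEval h (unit k)) :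
    unit k ≤ b := by
  obtain ⟨a, v, rfl, -⟩ := hs
  have := eq_of_mem_arslanStaircase hb (a := a) (v := v + unit k)
    (by rw [heq, arslanEval_add]; ring)
  rw [← this.2]
  exact le_add _ _

/-- The single factorization of a staircase value has length `degree b`, so this degree is its
𝔪-adic order. -/
theorem degree_of_eval_mem_level {h k : ℕ} {b : Exponent} (hb : b ∈ arslanStaircase h)
    (hs : arslanEval h b ∈ arslanLevel h k) : k ≤ degree b := by
  obtain ⟨a, v, heq, hk⟩ := hs
  obtain ⟨rfl, rfl⟩ := eq_of_mem_arslanStaircase hb heq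
  omega

/-- The first generator raises the level by exactly one. -/
theorem mem_arslanLevel_of_add {h : ℕ} (hh : 2 ≤ h) {s k : ℕ} (hs : s ∈ arslanLevel h 0)
    (hadd : s + h * (h + 1) ∈ arslanLevel h (k + 1)) : s ∈ arslanLevel h k := by
  rcases mem_arslanLevel_cases hh hadd with ⟨b, hb, heq, -⟩ | ⟨t, ht, heq⟩
  · exact absurd heq.symm (eval_ne_add_of_mem_level hb hs)
  · obtain rfl : s = t := by omega
    exact ht

/-! ### The semigroup rings of the Arslan semigroups -/

section SemigroupRingElements

variable {K : Type u} [Field K]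

theorem exists_polynomial_coeff_eq (g : ℕ → K) (N : ℕ) (hg : ∀ n, N < n → g n = 0) :
    ∃ P : Polynomial K, ∀ n, P.coeff n = g n := by
  refine ⟨∑ i ∈ Finset.range (N + 1), Polynomial.monomial i (g i), fun n => ?_⟩
  rw [Polynomial.finsetSum_coeff]
  simp only [Polynomial.coeff_monomial]
  rw [Finset.sum_ite_eq']
  by_cases hn : n ∈ Finset.range (N + 1)
  · rw [if_pos hn]
  · rw [if_neg hn, hg n (by rw [Finset.mem_range] at hn; omega)]

theorem mem_semigroupRing_iff {H : AddSubmonoid ℕ} {P : Polynomial K} :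
    P ∈ semigroupRing K H ↔ ∀ n, P.coeff n ≠ 0 → n ∈ H := by
  constructor
  · intro hP
    induction hP using Algebra.adjoin_induction with
    | mem P hP =>
      obtain ⟨s, hs, rfl⟩ := hP
      intro n hn
      rw [Polynomial.coeff_X_pow] at hn
      obtain rfl : n = s := by by_contra hne; simp [hne] at hn
      exact hs
    | algebraMap c =>
      intro n hn
      rw [Polynomial.algebraMap_apply, Polynomial.coeff_C] at hn
      obtain rfl : n = 0 := by by_contra hne; simp [hne] at hn
      exact H.zero_mem
    | add P Q _ _ hP hQ =>
      intro n hn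
      rw [Polynomial.coeff_add] at hn
      by_cases h0 : P.coeff n = 0
      · rw [h0, zero_add] at hn
        exact hQ n hn
      · exact hP n h0
    | mul P Q _ _ hP hQ =>
      intro n hn
      rw [Polynomial.coeff_mul] at hn
      obtain ⟨⟨i, j⟩, hij, hne⟩ := Finset.exists_ne_zero_of_sum_ne_zero hn
      rw [Finset.HasAntidiagonal.mem_antidiagonal] at hij
      rw [← hij]
      exact H.add_mem (hP i (left_ne_zero_of_mul hne)) (hQ j (right_ne_zero_of_mul hne))
  · intro hP
    rw [P.as_sum_support_C_mul_X_pow]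
    refine sum_mem fun n hn => mul_mem (Subalgebra.algebraMap_mem _ _) ?_
    exact Algebra.subset_adjoin ⟨n, hP n (Polynomial.mem_support_iff.1 hn), rfl⟩

end SemigroupRingElements

/-! ### The semigroup ring modulo its first generator. -/

section Arslan

variable (K : Type u) [Field K] (h : ℕ)

/-- The semigroup ring of the Arslan semigroup. -/
abbrev ArslanRing : Type u := semigroupRing K (generatedSemigroup (arslanGen h))

variable {K h}

theorem mem_level_of_coeff_ne_zero (f : ArslanRing K h) {n : ℕ} (hn : f.1.coeff n ≠ 0) :
    n ∈ arslanLevel h 0 :=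
  mem_generatedSemigroup_iff.1 (mem_semigroupRing_iff.1 f.2 n hn)

/-- The element of the Arslan ring with the given coefficients. -/
theorem exists_arslanRing_coeff_eq (g : ℕ → K) (N : ℕ) (hg : ∀ n, N < n → g n = 0)
    (hmem : ∀ n, g n ≠ 0 → n ∈ arslanLevel h 0) :
    ∃ f : ArslanRing K h, ∀ n, f.1.coeff n = g n := by
  obtain ⟨P, hP⟩ := exists_polynomial_coeff_eq g N hg
  refine ⟨⟨P, mem_semigroupRing_iff.2 fun n hn => ?_⟩, hP⟩
  rw [hP] at hn
  exact mem_generatedSemigroup_iff.2 (hmem n hn)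

theorem coeff_genMono_mul_zero (f : ArslanRing K h) (n : ℕ) :
    (genMono K (arslanGen h) 0 * f).1.coeff n =
      if h * (h + 1) ≤ n then f.1.coeff (n - h * (h + 1)) else 0 :=
  Polynomial.coeff_X_pow_mul' f.1 (h * (h + 1)) n

theorem coeff_genMono_mul_zero_add (f : ArslanRing K h) (n : ℕ) :
    (genMono K (arslanGen h) 0 * f).1.coeff (n + h * (h + 1)) = f.1.coeff n :=
  Polynomial.coeff_X_pow_mul f.1 (h * (h + 1)) n

theorem coeff_genMono_mul_zero_eval (f : ArslanRing K h) {b : Exponent}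
    (hb : b ∈ arslanStaircase h) :
    (genMono K (arslanGen h) 0 * f).1.coeff (arslanEval h b) = 0 := by
  rw [coeff_genMono_mul_zero]
  split_ifs with hle
  · by_contra hne
    exact eval_ne_add_of_mem_level hb (mem_level_of_coeff_ne_zero f hne)
      (Nat.sub_add_cancel hle).symm
  · rfl

/-- If the variable does not divide the staircase monomial, uniqueness of factorizations leaves no
term of `f` that the product could carry to its value. -/
theorem coeff_genMono_mul_eval (f : ArslanRing K h) {k : ℕ} (hk : k < 3) {b : Exponent}
    (hb : b ∈ arslanStaircase h) :
    (genMono K (arslanGen h) (Fin.ofNat 4 (k + 1)) * f).1.coeff (arslanEval h b) =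
      if unit k ≤ b then f.1.coeff (arslanEval h (b - unit k)) else 0 := by
  have h1 : (genMono K (arslanGen h) (Fin.ofNat 4 (k + 1)) * f).1 =
      Polynomial.X ^ arslanEval h (unit k) * f.1 := by
    rw [arslanEval_unit h hk]
    rfl
  rw [h1]
  split_ifs with hle
  · nth_rewrite 1 [← Exponent.sub_add_cancel hle]
    rw [arslanEval_add, Polynomial.coeff_X_pow_mul]
  · rw [Polynomial.coeff_X_pow_mul']
    split_ifs with hle'
    · by_contra hne
      exact hle (unit_le_of_eval_eq hb (mem_level_of_coeff_ne_zero f hne)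
        (Nat.sub_add_cancel hle').symm)
    · rfl

theorem exists_arslanRing_coeff_eval_eq (g : arslanStaircase h → K) :
    ∃ f : ArslanRing K h, ∀ b : arslanStaircase h, f.1.coeff (arslanEval h b) = g b := by
  classical
  have := finite_arslanStaircase h
  have := Fintype.ofFinite (arslanStaircase h)
  obtain ⟨f, hf⟩ := exists_arslanRing_coeff_eq (h := h)
    (fun n => ∑ b : arslanStaircase h, if n = arslanEval h b then g b else 0)
    -- A crude degree bound: the sum of the values dominates each of them.
    (∑ b : arslanStaircase h, arslanEval h b)
    (fun n hn => Finset.sum_eq_zero fun b _ => if_neg fun heq => by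
      have := Finset.single_le_sum (f := fun b : arslanStaircase h => arslanEval h b)
        (fun _ _ => Nat.zero_le _) (Finset.mem_univ b)
      omega)
    (fun n hn => by
      obtain ⟨b, -, hb⟩ := Finset.exists_ne_zero_of_sum_ne_zero hn
      have hn : n = arslanEval h b := by
        by_contra hne
        exact hb (if_neg hne)
      exact ⟨0, b, by rw [hn, zero_mul, zero_add], Nat.zero_le _⟩)
  refine ⟨f, fun b => ?_⟩
  rw [hf, Finset.sum_eq_single b]
  · exact if_pos rfl
  · intro c _ hcb
    exact if_neg fun heq => hcb (Subtype.ext (arslanEval_injOn h b.2 c.2 heq).symm)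
  · intro hb
    exact absurd (Finset.mem_univ b) hb

variable (K h)

/-- The coefficients at the values of the staircase. -/
def arslanRingToStaircase : ArslanRing K h →+ (arslanStaircase h → K) where
  toFun f b := f.1.coeff (arslanEval h b)
  map_zero' := funext fun _ => Polynomial.coeff_zero _
  map_add' f g := funext fun _ => Polynomial.coeff_add f.1 g.1 _

variable {K h}

/-- The ring is a domain, so x₀ is injective. An element whose coefficients vanish on the Apéry set
has only exponents from which the first generator can be subtracted, so it is a multiple of x₀. -/
theorem hasBettiSequence_arslanRing (hh : 2 ≤ h) :
    HasBettiSequence (moduleOfRingHom (semigroupRingPresentation K (arslanGen h)))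
      [1, 2 * h + 2, 4 * h, 2 * h - 1] := by
  have hXsmul : ∀ (i : Fin 4) (m : ArslanRing K h),
      semigroupRingPresentation K (arslanGen h) (MvPolynomial.X i) * m =
        genMono K (arslanGen h) i * m := fun i m =>
    congrArg (· * m) (MvPolynomial.aeval_X (genMono K (arslanGen h)) i)
  refine hasBettiSequence_of_arslanStaircase hh _ (arslanRingToStaircase K h) ?_ ?_ ?_ ?_ ?_
  · intro c (m : ArslanRing K h)
    have h1 : semigroupRingPresentation K (arslanGen h) (MvPolynomial.C c) =
        algebraMap K (ArslanRing K h) c := MvPolynomial.aeval_C (genMono K (arslanGen h)) c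
    change arslanRingToStaircase K h
      (semigroupRingPresentation K (arslanGen h) (MvPolynomial.C c) * m) = _
    rw [h1]
    funext b
    exact Polynomial.coeff_C_mul m.1
  · intro k hk (m : ArslanRing K h)
    change arslanRingToStaircase K h
      (semigroupRingPresentation K (arslanGen h) (MvPolynomial.X _) * m) = _
    rw [hXsmul]
    funext b
    refine (coeff_genMono_mul_eval m hk b.2).trans ?_
    rw [staircaseShift_apply]
    split_ifs with hle
    · exact (extendByZero_apply (arslanRingToStaircase K h m)
        ⟨_, sub_unit_mem_arslanStaircase h k b b.2 hle⟩).symm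
    · rfl
  · intro g
    obtain ⟨f, hf⟩ := exists_arslanRing_coeff_eval_eq g
    exact ⟨f, funext hf⟩
  · intro (m : ArslanRing K h) hm
    have hm' : genMono K (arslanGen h) 0 * m = 0 := (hXsmul 0 m).symm.trans hm
    refine Subtype.ext (Polynomial.ext fun n => ?_)
    rw [← coeff_genMono_mul_zero_add, hm']
    rfl
  · intro (m : ArslanRing K h)
    constructor
    · intro hm
      obtain ⟨f, hf⟩ := exists_arslanRing_coeff_eq (h := h)
        (fun n => m.1.coeff (n + h * (h + 1))) m.1.natDegree
        (fun n hn => Polynomial.coeff_eq_zero_of_natDegree_lt (by omega))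
        (fun n hn => by
          rcases mem_arslanLevel_cases hh (mem_level_of_coeff_ne_zero m hn) with
            ⟨b, hb, heq, -⟩ | ⟨t, ht, heq⟩
          · refine absurd (congrFun hm ⟨b, hb⟩) ?_
            change m.1.coeff (arslanEval h b) ≠ 0
            rwa [← heq]
          · obtain rfl : n = t := by omega
            exact ht)
      refine ⟨f, (hXsmul 0 f).trans (Subtype.ext (Polynomial.ext fun n => ?_))⟩
      rw [coeff_genMono_mul_zero]
      split_ifs with hle
      · rw [hf, Nat.sub_add_cancel hle]
      · refine Eq.symm (by_contra fun hne => ?_)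
        rcases mem_arslanLevel_cases hh (mem_level_of_coeff_ne_zero m hne) with
          ⟨b, hb, heq, -⟩ | ⟨t, ht, heq⟩
        · rw [heq] at hne
          exact hne (congrFun hm ⟨b, hb⟩)
        · omega
    · rintro ⟨(f : ArslanRing K h), hf⟩
      have hf' : genMono K (arslanGen h) 0 * f = m := (hXsmul 0 f).symm.trans hf
      funext b
      change m.1.coeff (arslanEval h b) = 0
      rw [← hf']
      exact coeff_genMono_mul_zero_eval f b.2

end Arslan

/-! ### The tangent cones of the Arslan semigroups -/

namespace AssocGraded

variable {R W : Type*} [CommRing R] {I : Ideal R} [AddCommGroup W] {k : ℕ}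

/-- The additive map on a graded piece that is induced by an additive map on the ring. -/
def pieceLift (g : R →+ W) (hg : ∀ r ∈ I ^ (k + 1), g r = 0) : Piece I k →+ W :=
  QuotientAddGroup.lift ((I ^ (k + 1)).submoduleOf (I ^ k)).toAddSubgroup
    (g.comp (I ^ k).subtype.toAddMonoidHom) fun r hr => hg r.1 hr

theorem pieceLift_cls (g : R →+ W) (hg : ∀ r ∈ I ^ (k + 1), g r = 0) (r : R) (hr : r ∈ I ^ k) :
    pieceLift g hg (cls k r hr) = g r := rfl

theorem of_cls_congr {i j : ℕ} {r s : R} (hij : i = j)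
    (hr : r ∈ I ^ i) (hs : s ∈ I ^ j) (hrs : r - s ∈ I ^ (i + 1)) :
    DirectSum.of (Piece I) i (cls i r hr) = DirectSum.of (Piece I) j (cls j s hs) := by
  subst hij
  rw [(cls_eq_iff hr hs).2 hrs]

end AssocGraded

section ArslanTangentCone

variable (K : Type u) [Field K] (h : ℕ)

/-- The elements of the Arslan ring whose exponents have level at least `k`. -/
def arslanLevelIdeal (k : ℕ) : Ideal (ArslanRing K h) where
  carrier := {f | ∀ n, f.1.coeff n ≠ 0 → n ∈ arslanLevel h k}
  zero_mem' := fun n hn => absurd (Polynomial.coeff_zero n) hn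
  add_mem' := by
    intro f g hf hg n hn
    by_cases h0 : f.1.coeff n = 0
    · refine hg n fun h1 => hn ?_
      refine (Polynomial.coeff_add f.1 g.1 n).trans ?_
      rw [h0, h1, add_zero]
    · exact hf n h0
  smul_mem' := by
    intro c f hf n hn
    have hn : (c.1 * f.1).coeff n ≠ 0 := hn
    rw [Polynomial.coeff_mul] at hn
    obtain ⟨⟨i, j⟩, hij, hne⟩ := Finset.exists_ne_zero_of_sum_ne_zero hn
    rw [Finset.HasAntidiagonal.mem_antidiagonal] at hij
    rw [← hij]
    have := add_mem_arslanLevel (mem_level_of_coeff_ne_zero c (left_ne_zero_of_mul hne))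
      (hf j (right_ne_zero_of_mul hne))
    rwa [zero_add] at this

variable {K h}

theorem arslanLevelIdeal_mul_le (i j : ℕ) :
    arslanLevelIdeal K h i * arslanLevelIdeal K h j ≤ arslanLevelIdeal K h (i + j) := by
  rw [Ideal.mul_le]
  intro f hf g hg n hn
  have hn : (f.1 * g.1).coeff n ≠ 0 := hn
  rw [Polynomial.coeff_mul] at hn
  obtain ⟨⟨i, j⟩, hij, hne⟩ := Finset.exists_ne_zero_of_sum_ne_zero hn
  rw [Finset.HasAntidiagonal.mem_antidiagonal] at hij
  rw [← hij]
  exact add_mem_arslanLevel (hf i (left_ne_zero_of_mul hne)) (hg j (right_ne_zero_of_mul hne))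

theorem mono_mem_arslanLevelIdeal {k s : ℕ} (hs : s ∈ generatedSemigroup (arslanGen h))
    (hk : s ∈ arslanLevel h k) : semigroupRing.mono s hs ∈ arslanLevelIdeal K h k := by
  intro n hn
  have hn : (Polynomial.X ^ s : Polynomial K).coeff n ≠ 0 := hn
  rw [Polynomial.coeff_X_pow] at hn
  obtain rfl : n = s := by by_contra hne; simp [hne] at hn
  exact hk

theorem genMono_pow_mem (ha : ∀ i, arslanGen h i ≠ 0) (i : Fin 4) (n : ℕ) :
    genMono K (arslanGen h) i ^ n ∈
      semigroupRing.maxIdeal K (generatedSemigroup (arslanGen h)) ^ n := by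
  have := genMono_mem K ha i
  rw [pow_one] at this
  exact Ideal.pow_mem_pow this n

/-- The powers of the maximal ideal of the Arslan ring. -/
theorem maxIdeal_pow_eq (ha : ∀ i, arslanGen h i ≠ 0) (k : ℕ) :
    semigroupRing.maxIdeal K (generatedSemigroup (arslanGen h)) ^ k = arslanLevelIdeal K h k := by
  refine le_antisymm ?_ ?_
  · induction k with
    | zero => exact fun f _ n hn => mem_level_of_coeff_ne_zero f hn
    | succ k ih =>
      rw [pow_succ]
      refine (Ideal.mul_mono ih ?_).trans (arslanLevelIdeal_mul_le k 1)
      rw [semigroupRing.maxIdeal, Ideal.span_le]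
      rintro _ ⟨s, hs, h0, rfl⟩
      exact mono_mem_arslanLevelIdeal hs
        (mem_arslanLevel_one (mem_generatedSemigroup_iff.1 hs) h0)
  -- Each monomial in the support has a factorization of length at least `k`, so it is a product of
  -- at least `k` generators of 𝔪.
  · intro f hf
    have hsum : f = ∑ n ∈ f.1.support.attach, algebraMap K (ArslanRing K h) (f.1.coeff n) *
        semigroupRing.mono n.1
          (mem_semigroupRing_iff.1 f.2 n.1 (Polynomial.mem_support_iff.1 n.2)) := by
      refine Subtype.ext ?_
      rw [AddSubmonoidClass.coe_finsetSum]
      refine f.1.as_sum_support_C_mul_X_pow.trans ?_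
      exact (Finset.sum_attach f.1.support
        fun n => Polynomial.C (f.1.coeff n) * Polynomial.X ^ n).symm
    rw [hsum]
    refine sum_mem fun n _ => Ideal.mul_mem_left _ _ ?_
    obtain ⟨a, v, heq, hk⟩ := hf n (Polynomial.mem_support_iff.1 n.2)
    have hprod : semigroupRing.mono n.1
          (mem_semigroupRing_iff.1 f.2 n.1 (Polynomial.mem_support_iff.1 n.2)) =
        genMono K (arslanGen h) 0 ^ a * (genMono K (arslanGen h) 1 ^ v.1 *
          genMono K (arslanGen h) 2 ^ v.2.1 * genMono K (arslanGen h) 3 ^ v.2.2) := by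
      refine Subtype.ext ?_
      change (Polynomial.X : Polynomial K) ^ n.1 = (Polynomial.X ^ (h * (h + 1))) ^ a *
        ((Polynomial.X ^ (h * (h + 1) + 1)) ^ v.1 * (Polynomial.X ^ ((h + 1) ^ 2)) ^ v.2.1 *
          (Polynomial.X ^ ((h + 1) ^ 2 + 1)) ^ v.2.2)
      rw [heq, arslanEval]
      ring
    rw [hprod]
    refine Ideal.pow_le_pow_right (m := k) (n := a + (v.1 + v.2.1 + v.2.2)) hk ?_
    rw [pow_add, pow_add, pow_add]
    exact Ideal.mul_mem_mul (genMono_pow_mem ha 0 a) (Ideal.mul_mem_mul (Ideal.mul_mem_mul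
      (genMono_pow_mem ha 1 _) (genMono_pow_mem ha 2 _)) (genMono_pow_mem ha 3 _))

theorem mem_maxIdeal_pow_iff (ha : ∀ i, arslanGen h i ≠ 0) {k : ℕ} {f : ArslanRing K h} :
    f ∈ semigroupRing.maxIdeal K (generatedSemigroup (arslanGen h)) ^ k ↔
      ∀ n, f.1.coeff n ≠ 0 → n ∈ arslanLevel h k := by
  rw [maxIdeal_pow_eq ha]
  rfl

/-- The graded pieces of the tangent cone. -/
abbrev ArslanPiece (K : Type u) [Field K] (h k : ℕ) : Type u :=
  AssocGraded.Piece (semigroupRing.maxIdeal K (generatedSemigroup (arslanGen h))) k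

/-- The coefficients at the points of the staircase of the given degree. -/
def arslanDegreeCoeff (K : Type u) [Field K] (h k : ℕ) :
    ArslanRing K h →+ (arslanStaircase h → K) where
  toFun f b := if degree b = k then f.1.coeff (arslanEval h b) else 0
  map_zero' := funext fun b => by
    split_ifs
    · exact Polynomial.coeff_zero _
    · rfl
  map_add' f g := funext fun b => by
    rw [Pi.add_apply]
    split_ifs
    · exact Polynomial.coeff_add f.1 g.1 _
    · exact (add_zero 0).symm

/-- The coefficients of a homogeneous element of the tangent cone at the points of the staircase of
the given degree. -/
def arslanPieceToStaircase (ha : ∀ i, arslanGen h i ≠ 0) (k : ℕ) :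
    ArslanPiece K h k →+ (arslanStaircase h → K) :=
  AssocGraded.pieceLift (arslanDegreeCoeff K h k) fun f hf => funext fun b => by
    rw [mem_maxIdeal_pow_iff ha] at hf
    change (if degree b = k then f.1.coeff (arslanEval h b) else 0) = 0
    split_ifs with hk
    · by_contra hne
      have := degree_of_eval_mem_level b.2 (hf _ hne)
      omega
    · rfl

theorem arslanPieceToStaircase_cls (ha : ∀ i, arslanGen h i ≠ 0) (k : ℕ) (f : ArslanRing K h)
    (hf : f ∈ semigroupRing.maxIdeal K (generatedSemigroup (arslanGen h)) ^ k)
    (b : arslanStaircase h) :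
    arslanPieceToStaircase ha k (AssocGraded.cls k f hf) b =
      if degree b = k then f.1.coeff (arslanEval h b) else 0 :=
  congrFun (AssocGraded.pieceLift_cls _ _ f hf) b

/-- The coefficients of an element of the tangent cone at the points of the staircase. -/
def tangentConeToStaircase (ha : ∀ i, arslanGen h i ≠ 0) :
    tangentCone K (generatedSemigroup (arslanGen h)) →+ (arslanStaircase h → K) :=
  DirectSum.toAddMonoid (arslanPieceToStaircase ha)

theorem tangentConeToStaircase_of (ha : ∀ i, arslanGen h i ≠ 0) (k : ℕ) (f : ArslanRing K h)
    (hf : f ∈ semigroupRing.maxIdeal K (generatedSemigroup (arslanGen h)) ^ k)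
    (b : arslanStaircase h) :
    tangentConeToStaircase ha (DirectSum.of (ArslanPiece K h) k (AssocGraded.cls k f hf)) b =
      if degree b = k then f.1.coeff (arslanEval h b) else 0 := by
  rw [tangentConeToStaircase, DirectSum.toAddMonoid_of, arslanPieceToStaircase_cls]

theorem tangentCone_induction {H : AddSubmonoid ℕ} {p : tangentCone K H → Prop}
    (x : tangentCone K H)
    (of : ∀ (k : ℕ) (f : semigroupRing K H) (hf : f ∈ semigroupRing.maxIdeal K H ^ k),
      p (DirectSum.of (AssocGraded.Piece (semigroupRing.maxIdeal K H)) k (AssocGraded.cls k f hf)))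
    (add : ∀ x y, p x → p y → p (x + y)) : p x := by
  induction x using DirectSum.induction_on with
  | zero =>
    rw [← map_zero (DirectSum.of (AssocGraded.Piece (semigroupRing.maxIdeal K H)) 0)]
    exact of 0 0 (zero_mem _)
  | of k y =>
    obtain ⟨f, hf, rfl⟩ := AssocGraded.exists_cls y
    exact of k f hf
  | add x y hx hy => exact add x y hx hy

/-- The class of a generator in degree one. -/
def initialForm (ha : ∀ i, arslanGen h i ≠ 0) (i : Fin 4) :
    tangentCone K (generatedSemigroup (arslanGen h)) :=
  DirectSum.of (ArslanPiece K h) 1 (AssocGraded.cls 1 (genMono K (arslanGen h) i)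
    (genMono_mem K ha i))

theorem initialForm_mul_of (ha : ∀ i, arslanGen h i ≠ 0) (i : Fin 4) (k : ℕ) (f : ArslanRing K h)
    (hf : f ∈ semigroupRing.maxIdeal K (generatedSemigroup (arslanGen h)) ^ k) :
    initialForm ha i * DirectSum.of (ArslanPiece K h) k (AssocGraded.cls k f hf) =
      DirectSum.of (ArslanPiece K h) (1 + k)
        (AssocGraded.cls (1 + k) (genMono K (arslanGen h) i * f)
          (AssocGraded.mul_mem_pow (genMono_mem K ha i) hf)) :=
  DirectSum.of_mul_of _ _

/-- The coefficient formula is that of the ring; what is added is that removing one variable lowers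
the degree by one, so the degree filters on the two sides agree. -/
theorem tangentConeToStaircase_initialForm_mul (ha : ∀ i, arslanGen h i ≠ 0) {k : ℕ} (hk : k < 3)
    (x : tangentCone K (generatedSemigroup (arslanGen h))) :
    tangentConeToStaircase ha (initialForm ha (Fin.ofNat 4 (k + 1)) * x) =
      staircaseShift K (arslanStaircase h) k (tangentConeToStaircase ha x) := by
  induction x using tangentCone_induction with
  | add x y hx hy => rw [mul_add, map_add, hx, hy, map_add, map_add]
  | of l f hf =>
    rw [initialForm_mul_of]
    funext b
    rw [tangentConeToStaircase_of, coeff_genMono_mul_eval f hk b.2, staircaseShift_apply]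
    split_ifs with hdeg hle hle
    · have hmem := sub_unit_mem_arslanStaircase h k b b.2 hle
      refine Eq.trans ?_ (extendByZero_apply _ ⟨_, hmem⟩).symm
      rw [tangentConeToStaircase_of, if_pos]
      have := degree_add (b - unit k) (unit k)
      rw [Exponent.sub_add_cancel hle, degree_unit] at this
      simp only
      omega
    · rfl
    · have hmem := sub_unit_mem_arslanStaircase h k b b.2 hle
      refine Eq.trans ?_ (extendByZero_apply _ ⟨_, hmem⟩).symm
      rw [tangentConeToStaircase_of, if_neg]
      have := degree_add (b - unit k) (unit k)
      rw [Exponent.sub_add_cancel hle, degree_unit] at this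
      simp only
      omega
    · rfl

theorem tangentConeToStaircase_initialForm_zero_mul (ha : ∀ i, arslanGen h i ≠ 0)
    (x : tangentCone K (generatedSemigroup (arslanGen h))) :
    tangentConeToStaircase ha (initialForm ha 0 * x) = 0 := by
  induction x using tangentCone_induction with
  | add x y hx hy => rw [mul_add, map_add, hx, hy, add_zero]
  | of l f hf =>
    rw [initialForm_mul_of]
    funext b
    rw [tangentConeToStaircase_of, coeff_genMono_mul_zero_eval f b.2, ite_self]
    rfl

/-- A staircase monomial lies in the power of 𝔪 given by its degree, and its class there maps to the
indicator function of that point. -/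
theorem tangentConeToStaircase_surjective (ha : ∀ i, arslanGen h i ≠ 0) :
    Function.Surjective (tangentConeToStaircase (K := K) ha) := by
  classical
  have := finite_arslanStaircase h
  have := Fintype.ofFinite (arslanStaircase h)
  have hsingle : ∀ (b : arslanStaircase h) (c : K), ∃ x, tangentConeToStaircase ha x =
      Pi.single b c := by
    intro b c
    obtain ⟨f, hf⟩ := exists_arslanRing_coeff_eq (h := h)
      (fun n => if n = arslanEval h b then c else 0) (arslanEval h b)
      (fun n hn => if_neg hn.ne')
      (fun n hn => by
        have hn : n = arslanEval h b := by
          by_contra hne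
          exact hn (if_neg hne)
        exact ⟨0, b, by rw [hn, zero_mul, zero_add], Nat.zero_le _⟩)
    have hmem : f ∈ semigroupRing.maxIdeal K (generatedSemigroup (arslanGen h)) ^
        degree (b : Exponent) := by
      rw [mem_maxIdeal_pow_iff ha]
      intro n hn
      rw [hf] at hn
      have hn : n = arslanEval h b := by
        by_contra hne
        exact hn (if_neg hne)
      exact ⟨0, b, by rw [hn, zero_mul, zero_add], by omega⟩
    refine ⟨DirectSum.of (ArslanPiece K h) _ (AssocGraded.cls _ f hmem), funext fun b' => ?_⟩
    rw [tangentConeToStaircase_of, hf]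
    by_cases hbb : b' = b
    · subst hbb
      simp
    · rw [Pi.single_eq_of_ne hbb]
      split_ifs with h1 h2
      · exact absurd (Subtype.ext (arslanEval_injOn h b'.2 b.2 h2)) hbb
      · rfl
      · rfl
  intro g
  choose x hx using fun b => hsingle b (g b)
  refine ⟨∑ b, x b, ?_⟩
  rw [map_sum]
  simp only [hx]
  exact Finset.univ_sum_single g

theorem initialForm_zero_mul_apply (ha : ∀ i, arslanGen h i ≠ 0)
    (x : tangentCone K (generatedSemigroup (arslanGen h))) (k : ℕ) :
    (initialForm ha 0 * x : tangentCone K (generatedSemigroup (arslanGen h))) (1 + k) =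
      AssocGraded.mulHom _ 1 k
      (AssocGraded.cls 1 (genMono K (arslanGen h) 0) (genMono_mem K ha 0)) (x k) := by
  induction x using DirectSum.induction_on with
  | zero =>
    rw [mul_zero]
    exact (map_zero _).symm
  | add x y hx hy =>
    rw [mul_add, DirectSum.add_apply, DirectSum.add_apply, hx, hy, map_add]
  | of l y =>
    have h1 : initialForm ha 0 * DirectSum.of (ArslanPiece K h) l y =
        DirectSum.of (ArslanPiece K h) (1 + l) (AssocGraded.mulHom _ 1 l
          (AssocGraded.cls 1 (genMono K (arslanGen h) 0) (genMono_mem K ha 0)) y) :=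
      DirectSum.of_mul_of _ _
    rw [h1]
    by_cases hlk : l = k
    · subst hlk
      rw [DirectSum.of_eq_same, DirectSum.of_eq_same]
    · rw [DirectSum.of_eq_of_ne _ _ _ (by omega), DirectSum.of_eq_of_ne _ _ _ (by omega), map_zero]

/-- In each degree, if x₀ times a representative drops into the next power of 𝔪, so does the
representative, because the first generator raises the level by exactly one. -/
theorem eq_zero_of_initialForm_zero_mul (hh : 2 ≤ h) (ha : ∀ i, arslanGen h i ≠ 0)
    (x : tangentCone K (generatedSemigroup (arslanGen h))) (hx : initialForm ha 0 * x = 0) :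
    x = 0 := by
  refine DFinsupp.ext fun k => ?_
  have h1 := initialForm_zero_mul_apply ha x k
  rw [hx] at h1
  obtain ⟨f, hf, hfx⟩ := AssocGraded.exists_cls (x k)
  rw [← hfx] at h1 ⊢
  rw [AssocGraded.mulHom_cls] at h1
  have h2 := (Submodule.Quotient.mk_eq_zero _).1 h1.symm
  have h3 : genMono K (arslanGen h) 0 * f ∈
    semigroupRing.maxIdeal K (generatedSemigroup (arslanGen h)) ^ (1 + k + 1) := h2
  refine (Submodule.Quotient.mk_eq_zero _).2 ?_
  change f ∈ semigroupRing.maxIdeal K (generatedSemigroup (arslanGen h)) ^ (k + 1)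
  rw [mem_maxIdeal_pow_iff ha] at h3 ⊢
  intro n hn
  refine mem_arslanLevel_of_add hh (mem_level_of_coeff_ne_zero f hn) ?_
  have := h3 (n + h * (h + 1)) (by rwa [coeff_genMono_mul_zero_add])
  rwa [add_comm 1 k] at this

theorem tangentConeToStaircase_apply (ha : ∀ i, arslanGen h i ≠ 0)
    (x : tangentCone K (generatedSemigroup (arslanGen h))) (b : arslanStaircase h) :
    tangentConeToStaircase ha x b =
      arslanPieceToStaircase ha (degree (b : Exponent)) (x (degree (b : Exponent))) b := by
  induction x using DirectSum.induction_on with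
  | zero =>
    rw [map_zero]
    exact (congrFun (map_zero (arslanPieceToStaircase ha (degree (b : Exponent)))) b).symm
  | add x y hx hy =>
    rw [map_add, Pi.add_apply, hx, hy, DirectSum.add_apply, map_add, Pi.add_apply]
  | of k y =>
    rw [tangentConeToStaircase, DirectSum.toAddMonoid_of]
    by_cases hk : k = degree (b : Exponent)
    · subst hk
      rw [DirectSum.of_eq_same]
    · rw [DirectSum.of_eq_of_ne _ _ _ (Ne.symm hk), map_zero]
      obtain ⟨f, hf, rfl⟩ := AssocGraded.exists_cls y
      rw [arslanPieceToStaircase_cls, if_neg (Ne.symm hk)]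
      rfl

/-- Modulo the next power of 𝔪, every term of `f` is divisible by x₀ with quotient of level `k - 1`:
a term without such a quotient sits at a staircase value of degree at least `k`, and degree `k` is
excluded by assumption. -/
theorem exists_initialForm_mul_of (hh : 2 ≤ h) (ha : ∀ i, arslanGen h i ≠ 0) (k : ℕ)
    (f : ArslanRing K h)
    (hf : f ∈ semigroupRing.maxIdeal K (generatedSemigroup (arslanGen h)) ^ k)
    (h0 : ∀ b ∈ arslanStaircase h, degree b = k → f.1.coeff (arslanEval h b) = 0) :
    ∃ x, initialForm ha 0 * x = DirectSum.of (ArslanPiece K h) k (AssocGraded.cls k f hf) := by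
  classical
  have hlevel := (mem_maxIdeal_pow_iff ha).1 hf
  have hcases : ∀ n, f.1.coeff n ≠ 0 → n ∈ arslanLevel h (k + 1) ∨
      ∃ t ∈ arslanLevel h (k - 1), n = t + h * (h + 1) := by
    intro n hn
    rcases mem_arslanLevel_cases hh (hlevel n hn) with ⟨b, hb, rfl, hdeg⟩ | ht
    · refine Or.inl ⟨0, b, by rw [zero_mul, zero_add], ?_⟩
      have := mt (h0 b hb) hn
      omega
    · exact Or.inr ht
  obtain _ | k := k
  -- In degree zero the only staircase point is the origin, so `f` has no constant term and its
  -- class is zero.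
  · refine ⟨0, ?_⟩
    rw [mul_zero, ← map_zero (DirectSum.of (ArslanPiece K h) 0)]
    refine congrArg _ (Eq.symm ((Submodule.Quotient.mk_eq_zero _).2 ?_))
    change f ∈ semigroupRing.maxIdeal K (generatedSemigroup (arslanGen h)) ^ (0 + 1)
    rw [mem_maxIdeal_pow_iff ha]
    intro n hn
    refine mem_arslanLevel_one (hlevel n hn) ?_
    rintro rfl
    refine hn ?_
    have := h0 0 (Or.inl ⟨rfl, by change 0 + 0 < h; omega⟩) rfl
    simpa [arslanEval] using this
  -- Only quotients of level `k` are kept, so that `g` lies in 𝔪ᵏ; the terms of `f` not matched in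
  -- this way have level `k + 2` and vanish in the piece of degree `k + 1`.
  · obtain ⟨g, hg⟩ := exists_arslanRing_coeff_eq (h := h)
      (fun n => if n ∈ arslanLevel h k then f.1.coeff (n + h * (h + 1)) else 0) f.1.natDegree
      (fun n hn => by
        rw [Polynomial.coeff_eq_zero_of_natDegree_lt (by omega), ite_self])
      (fun n hn => by
        by_contra hne
        exact hn (if_neg fun hmem => hne (arslanLevel_anti (Nat.zero_le k) hmem)))
    have hgmem : g ∈ semigroupRing.maxIdeal K (generatedSemigroup (arslanGen h)) ^ k := by
      rw [mem_maxIdeal_pow_iff ha]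
      intro n hn
      rw [hg] at hn
      by_contra hne
      exact hn (if_neg hne)
    refine ⟨DirectSum.of (ArslanPiece K h) k (AssocGraded.cls k g hgmem), ?_⟩
    rw [initialForm_mul_of]
    refine AssocGraded.of_cls_congr (add_comm 1 k) _ _ ?_
    rw [mem_maxIdeal_pow_iff ha]
    intro n hn
    have hn : (genMono K (arslanGen h) 0 * g).1.coeff n - f.1.coeff n ≠ 0 := by
      rwa [← Polynomial.coeff_sub]
    rw [coeff_genMono_mul_zero] at hn
    rw [add_comm 1 k]
    by_cases ht : ∃ t ∈ arslanLevel h k, n = t + h * (h + 1)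
    · obtain ⟨t, ht, rfl⟩ := ht
      refine absurd ?_ hn
      rw [if_pos (by omega), Nat.add_sub_cancel, hg, if_pos ht, sub_self]
    · have hfn : f.1.coeff n ≠ 0 := by
        intro hf0
        rw [hf0, sub_zero] at hn
        split_ifs at hn with hle
        · rw [hg] at hn
          exact hn (if_neg fun hmem => ht ⟨_, hmem, (Nat.sub_add_cancel hle).symm⟩)
        · exact hn rfl
      exact (hcases n hfn).resolve_right ht

/-- The staircase coefficients of degree `k` depend only on the component of degree `k`, so each
component can be divided by x₀ separately, and a finite sum of the quotients divides the element. -/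
theorem exists_initialForm_mul_eq (hh : 2 ≤ h) (ha : ∀ i, arslanGen h i ≠ 0)
    (x : tangentCone K (generatedSemigroup (arslanGen h)))
    (hx : tangentConeToStaircase ha x = 0) : ∃ x', initialForm ha 0 * x' = x := by
  classical
  have hpiece : ∀ k, ∃ x', initialForm ha 0 * x' = DirectSum.of (ArslanPiece K h) k (x k) := by
    intro k
    obtain ⟨f, hf, hfx⟩ := AssocGraded.exists_cls (x k)
    rw [← hfx]
    refine exists_initialForm_mul_of hh ha k f hf fun b hb hdeg => ?_
    have h1 := tangentConeToStaircase_apply ha x ⟨b, hb⟩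
    rw [hx] at h1
    subst hdeg
    rw [← hfx, arslanPieceToStaircase_cls, if_pos rfl] at h1
    exact h1.symm
  choose y hy using hpiece
  refine ⟨∑ k ∈ DFinsupp.support x, y k, ?_⟩
  rw [Finset.mul_sum]
  simp only [hy]
  exact DirectSum.sum_support_of x

theorem hasBettiSequence_tangentCone (hh : 2 ≤ h) (ha : ∀ i, arslanGen h i ≠ 0) :
    HasBettiSequence (moduleOfRingHom (tangentConePresentation K ha))
      [1, 2 * h + 2, 4 * h, 2 * h - 1] := by
  have hXsmul : ∀ (i : Fin 4) (m : tangentCone K (generatedSemigroup (arslanGen h))),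
      tangentConePresentation K ha (MvPolynomial.X i) * m = initialForm ha i * m := fun i m =>
    congrArg (· * m) (MvPolynomial.eval₂Hom_X' _ _ i)
  refine hasBettiSequence_of_arslanStaircase hh _ (tangentConeToStaircase ha) ?_ ?_ ?_ ?_ ?_
  · intro c (m : tangentCone K (generatedSemigroup (arslanGen h)))
    have h1 : tangentConePresentation K ha (MvPolynomial.C c) =
        DirectSum.of (ArslanPiece K h) 0 (AssocGraded.cls 0 (algebraMap K (ArslanRing K h) c)
          (AssocGraded.mem_pow_zero _)) := MvPolynomial.eval₂Hom_C _ _ c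
    change tangentConeToStaircase ha (tangentConePresentation K ha (MvPolynomial.C c) * m) =
      c • tangentConeToStaircase ha m
    rw [h1]
    induction m using tangentCone_induction with
    | add x y hx hy => rw [mul_add, map_add, hx, hy, map_add, smul_add]
    | of l f hf =>
      have h2 := DirectSum.of_mul_of (A := ArslanPiece K h)
        (AssocGraded.cls 0 (algebraMap K (ArslanRing K h) c) (AssocGraded.mem_pow_zero _))
        (AssocGraded.cls l f hf)
      have h3 : GradedMonoid.GMul.mul (A := ArslanPiece K h)
          (AssocGraded.cls 0 (algebraMap K (ArslanRing K h) c) (AssocGraded.mem_pow_zero _))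
          (AssocGraded.cls l f hf) = AssocGraded.cls (0 + l) (algebraMap K (ArslanRing K h) c * f)
            (AssocGraded.mul_mem_pow (AssocGraded.mem_pow_zero _) hf) := rfl
      rw [h2, h3]
      funext b
      rw [Pi.smul_apply, tangentConeToStaircase_of, tangentConeToStaircase_of, zero_add]
      split_ifs
      · exact Polynomial.coeff_C_mul f.1
      · exact (smul_zero c).symm
  · intro k hk (m : tangentCone K (generatedSemigroup (arslanGen h)))
    change tangentConeToStaircase ha (tangentConePresentation K ha (MvPolynomial.X _) * m) = _
    rw [hXsmul]
    exact tangentConeToStaircase_initialForm_mul ha hk m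
  · exact tangentConeToStaircase_surjective ha
  · intro (m : tangentCone K (generatedSemigroup (arslanGen h))) hm
    exact eq_zero_of_initialForm_zero_mul hh ha m ((hXsmul 0 m).symm.trans hm)
  · intro (m : tangentCone K (generatedSemigroup (arslanGen h)))
    constructor
    · intro hm
      obtain ⟨x, hx⟩ := exists_initialForm_mul_eq hh ha m hm
      exact ⟨x, (hXsmul 0 x).trans hx⟩
    · rintro ⟨(x : tangentCone K (generatedSemigroup (arslanGen h))), hx⟩
      have hx' : initialForm ha 0 * x = m := (hXsmul 0 x).symm.trans hx
      rw [← hx']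
      exact tangentConeToStaircase_initialForm_zero_mul ha x

end ArslanTangentCone

theorem proposition7p3 (K : Type*) [Field K] (h : ℕ) (hh : 2 ≤ h) :
    HasBettiSequence (moduleOfRingHom (semigroupRingPresentation K (arslanGen h)))
      [1, 2 * h + 2, 4 * h, 2 * h - 1] ∧
    HasBettiSequence (moduleOfRingHom (tangentConePresentation K (arslanGen_ne_zero hh)))
      [1, 2 * h + 2, 4 * h, 2 * h - 1] :=
  ⟨hasBettiSequence_arslanRing hh, hasBettiSequence_tangentCone hh _⟩

end
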